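/- **The AGJ localization property.** Let $R$ be a ring, $\mathrm{Mod}(R)$ the category of right $R$-modules and $\mathrm{mod}(R^{op})$ the category of finitely presented left $R$-modules. All functors are additive. Write $(X,-)=\mathrm{Hom}(X,-)$. Let $\mathrm{fp}(\mathrm{Mod}(R),\mathrm{Ab})$ be the category of finitely presented functors $F:\mathrm{Mod}(R)\to\mathrm{Ab}$, i.e. those admitting an exact sequence $(Y,-)\to(X,-)\to F\to 0$. It is abelian with enough projectives, and the Yoneda embedding $\mathsf Y: X\mapsto (X,-)$, as a functor $\mathrm{Mod}(R)^{op}\to\mathrm{fp}(\mathrm{Mod}(R),\mathrm{Ab})$, has a left adjoint $w$. Let $(\mathrm{mod}(R^{op}),\mathrm{Ab})$ be the abelian category of additive functors $\mathrm{mod}(R^{op})\to\mathrm{Ab}$; it has enough injectives. Let $t:\mathrm{Mod}(R)\to(\mathrm{mod}(R^{op}),\mathrm{Ab})$, $t(X)=X\otimes_R-$, be the tensor embedding, and let $\mathrm{ev}_R:(\mathrm{mod}(R^{op}),\mathrm{Ab})\to\mathrm{Mod}(R)$, $\mathrm{ev}_R(G)=G(R)$, where $r\in R$ acts on $G(R)$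 by $G$ of the right multiplication by $r$. Define the contravariant functors $$\mathsf D_A=R_0(t\circ w):\mathrm{fp}(\mathrm{Mod}(R),\mathrm{Ab})\to(\mathrm{mod}(R^{op}),\mathrm{Ab}),\qquad \mathsf D_L=L^0(\mathsf Y\circ \mathrm{ev}_R):(\mathrm{mod}(R^{op}),\mathrm{Ab})\to\mathrm{fp}(\mathrm{Mod}(R),\mathrm{Ab}),$$ where $R_0$ of a contravariant functor is the zeroth derived functor computed by applying it to projective resolutions and taking cohomology in degree $0$, and $L^0$ is the zeroth derived functor computed by applying it to injective resolutions and taking homology in degree $0$. Put $\ker\mathsf D_A=\{F : \mathsf D_AF=0\}$. A short exact sequence $0\to X\to Y\to Z\to 0$ in $\mathrm{Mod}(R)$ is *pure exact* if $0\to X\otimes_R-\to Y\otimes_R-\to Z\otimes_R-\to 0$ is exact in $(\mathrm{mod}(R^{op}),\mathrm{Ab})$. A functor $F\in\mathrm{fp}(\mathrm{Mod}(R),\mathrm{Ab})$ *arises from a pure exact sequence* if there are a pure exact sequence $0\to X\to Y\to Z\to 0$ and an exact sequence $0\to(Z,-)\to(Y,-)\to(X,-)\to F\to 0$ in which the maps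 between representable functors are the induced ones. Then: 1. Let $\mathcal A$ be any abelian category and $\mathcal E:\mathrm{fp}(\mathrm{Mod}(R),\mathrm{Ab})\to\mathcal A$ any exact functor such that $\mathcal E F=0$ whenever $\mathsf D_AF=0$. Then the contravariant functor $\mathcal E\mathsf D_L:(\mathrm{mod}(R^{op}),\mathrm{Ab})\to\mathcal A$ is exact and $\mathcal E\mathsf D_L\mathsf D_A\cong\mathcal E$; and every exact contravariant functor $\Theta:(\mathrm{mod}(R^{op}),\mathrm{Ab})\to\mathcal A$ with $\Theta\mathsf D_A\cong\mathcal E$ is isomorphic to $\mathcal E\mathsf D_L$. 2. $\mathsf D_A$ is exact, $\ker\mathsf D_A$ is a Serre subcategory of $\mathrm{fp}(\mathrm{Mod}(R),\mathrm{Ab})$, and $\mathsf D_A$, viewed as a covariant functor to $(\mathrm{mod}(R^{op}),\mathrm{Ab})^{op}$, is a Serre localization at $\ker\mathsf D_A$, that is, a localization at the class of morphisms whose kernel and cokernel lie in $\ker\mathsf D_A$. It induces an equivalence $$\mathrm{fp}(\mathrm{Mod}(R),\mathrm{Ab})/\ker\mathsf D_A\;\simeq\;(\mathrm{mod}(R^{op}),\mathrm{Ab})^{op}$$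 whose composite with the quotient functor is isomorphic to $\mathsf D_A$. 3. $F\in\mathrm{fp}(\mathrm{Mod}(R),\mathrm{Ab})$ satisfies $\mathsf D_AF=0$ if and only if $F$ arises from a pure exact sequence. -/

import Mathlib

open CategoryTheory CategoryTheory.Limits Opposite ZeroObject
open scoped TensorProduct

universe v u v₁ u₁

namespace AGJ

section Pointwise

variable {C : Type u} [Category.{v} C] [Preadditive C]

lemma nat_apply {D : Type*} [Category* D] {F G : D ⥤ AddCommGrpCat.{v}} (α : F ⟶ G) {A B : D}
    (k : A ⟶ B) (x : F.obj A) : α.app B (F.map k x) = G.map k (α.app A x) :=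
  ConcreteCategory.congr_hom (α.naturality k) x

lemma map_comp_apply' {D : Type*} [Category* D] (F : D ⥤ AddCommGrpCat.{v}) {A B E : D}
    (k : A ⟶ B) (l : B ⟶ E) (x : F.obj A) : F.map (k ≫ l) x = F.map l (F.map k x) := by
  rw [F.map_comp]; rfl

lemma map_sub_apply' (F : C ⥤ AddCommGrpCat.{v}) [F.Additive] {A B : C}
    (k l : A ⟶ B) (x : F.obj A) : F.map (k - l) x = F.map k x - F.map l x := by
  rw [F.map_sub]; rfl

lemma map_add_apply' (F : C ⥤ AddCommGrpCat.{v}) [F.Additive] {A B : C}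
    (k l : A ⟶ B) (x : F.obj A) : F.map (k + l) x = F.map k x + F.map l x := by
  rw [F.map_add]; rfl

lemma additive_of_surj {G H : C ⥤ AddCommGrpCat.{v}} [G.Additive] (π : G ⟶ H)
    (h : ∀ A, Function.Surjective (π.app A)) : H.Additive where
  map_add {X Y f g} := by
    ext z
    obtain ⟨y, rfl⟩ := h X z
    have nat (k : X ⟶ Y) : H.map k (π.app X y) = π.app Y (G.map k y) :=
      (ConcreteCategory.congr_hom (π.naturality k) y).symm
    change H.map (f + g) (π.app X y) = H.map f (π.app X y) + H.map g (π.app X y)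
    rw [nat, nat, nat, G.map_add, ← map_add]; rfl

lemma additive_of_inj {G H : C ⥤ AddCommGrpCat.{v}} [H.Additive] (ι : G ⟶ H)
    (h : ∀ A, Function.Injective (ι.app A)) : G.Additive where
  map_add {X Y f g} := by
    ext z
    have nat (k : X ⟶ Y) : ι.app Y (G.map k z) = H.map k (ι.app X z) :=
      (ConcreteCategory.congr_hom (ι.naturality k) z)
    apply h
    change ι.app Y (G.map (f + g) z) = ι.app Y (G.map f z + G.map g z)
    rw [map_add, nat, nat, nat, H.map_add]; rfl

lemma additive_of_jointly_injective {F G B : C ⥤ AddCommGrpCat.{v}} [F.Additive] [G.Additive]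
    (p : B ⟶ F) (q : B ⟶ G)
    (h : ∀ (A : C) (y : B.obj A), p.app A y = 0 → q.app A y = 0 → y = 0) : B.Additive where
  map_add {A A' g k} := by
    ext y
    change B.map (g + k) y = B.map g y + B.map k y
    rw [← sub_eq_zero]
    apply h <;> simp only [map_sub, map_add, nat_apply, map_add_apply', sub_self]

lemma surjective_app_of_epi {D : Type*} [Category* D] {G H : D ⥤ AddCommGrpCat.{v}} (π : G ⟶ H)
    [Epi π] (A : D) : Function.Surjective (π.app A) := by
  rw [← AddCommGrpCat.epi_iff_surjective]
  infer_instance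

lemma injective_app_of_mono {D : Type*} [Category* D] {G H : D ⥤ AddCommGrpCat.{v}} (π : G ⟶ H)
    [Mono π] (A : D) : Function.Injective (π.app A) := by
  rw [← AddCommGrpCat.mono_iff_injective]
  infer_instance

lemma exact_app_of_cokernel {D : Type*} [Category* D] {F G : D ⥤ AddCommGrpCat.{v}} {α : F ⟶ G}
    {k : CokernelCofork α} (hk : IsColimit k) (A : D) : Function.Exact (α.app A) (k.π.app A) := by
  have h := CokernelCofork.mapIsColimit _ hk ((evaluation D AddCommGrpCat.{v}).obj A)
  have := ShortComplex.exact_of_g_is_cokernel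
    (ShortComplex.mk (α.app A) (k.π.app A) (by rw [← NatTrans.comp_app, k.condition]; rfl)) h
  exact (ShortComplex.ab_exact_iff_function_exact _).1 this

lemma exact_app_of_kernel {D : Type*} [Category* D] {F G : D ⥤ AddCommGrpCat.{v}} {α : F ⟶ G}
    {k : KernelFork α} (hk : IsLimit k) (A : D) : Function.Exact (k.ι.app A) (α.app A) := by
  have h := KernelFork.mapIsLimit _ hk ((evaluation D AddCommGrpCat.{v}).obj A)
  have := ShortComplex.exact_of_f_is_kernel
    (ShortComplex.mk (k.ι.app A) (α.app A) (by rw [← NatTrans.comp_app, k.condition]; rfl)) h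
  exact (ShortComplex.ab_exact_iff_function_exact _).1 this

end Pointwise

section FinPres

variable {C : Type u} [Category.{v} C] [Abelian C]

/-- `G ⟶ H ⟶ F ⟶ 0` is exact when evaluated at any object. -/
def IsRightExactSeq {G H F : C ⥤ AddCommGrpCat.{v}} (α : G ⟶ H) (π : H ⟶ F) : Prop :=
  ∀ A : C, Function.Exact (α.app A) (π.app A) ∧ Function.Surjective (π.app A)

variable (C) in
/-- Finitely presented functors: there is an exact sequence `(Y, -) ⟶ (X, -) ⟶ F ⟶ 0`.
(Such a functor is automatically additive.) -/
def finPres : ObjectProperty (C ⥤ AddCommGrpCat.{v}) := fun F =>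
  ∃ (X Y : C) (α : preadditiveCoyoneda.obj (op Y) ⟶ preadditiveCoyoneda.obj (op X))
    (π : preadditiveCoyoneda.obj (op X) ⟶ F), IsRightExactSeq α π

/-- The element of `F X` corresponding to a natural transformation `(X, -) ⟶ F`. -/
def elt {F : C ⥤ AddCommGrpCat.{v}} {X : C} (π : preadditiveCoyoneda.obj (op X) ⟶ F) :
    F.obj X := π.app X (𝟙 X : X ⟶ X)

lemma app_eq {F : C ⥤ AddCommGrpCat.{v}} {X : C} (π : preadditiveCoyoneda.obj (op X) ⟶ F)
    {A : C} (g : X ⟶ A) : π.app A g = F.map g (elt π) := by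
  have := ConcreteCategory.congr_hom (π.naturality g) (𝟙 X : X ⟶ X)
  refine Eq.trans ?_ this
  refine congrArg (π.app A) ?_
  exact (Category.id_comp g).symm

/-- The natural transformation `(X, -) ⟶ F` corresponding to an element of `F X`. -/
def ofElt (F : C ⥤ AddCommGrpCat.{v}) [F.Additive] {X : C} (x : F.obj X) :
    preadditiveCoyoneda.obj (op X) ⟶ F where
  app A := AddCommGrpCat.ofHom (AddMonoidHom.mk' (fun g : X ⟶ A => F.map g x)
    (fun g h => map_add_apply' F (g : X ⟶ A) (h : X ⟶ A) x))
  naturality A B k := by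
    ext g
    exact map_comp_apply' F (g : X ⟶ A) k x

lemma ofElt_app {F : C ⥤ AddCommGrpCat.{v}} [F.Additive] {X : C} (x : F.obj X) {A : C}
    (g : X ⟶ A) : (ofElt F x).app A g = F.map g x := rfl

lemma elt_ofElt (F : C ⥤ AddCommGrpCat.{v}) [F.Additive] {X : C} (x : F.obj X) :
    elt (ofElt F x) = x := by
  change F.map (𝟙 X) x = x
  simp

/-- A presentation by `(f, -)` expressed through the image `x` of `𝟙 X`. -/
structure EltPres (F : C ⥤ AddCommGrpCat.{v}) {X Y : C} (f : X ⟶ Y) (x : F.obj X) : Prop where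
  gen : ∀ (A : C) (z : F.obj A), ∃ g : X ⟶ A, F.map g x = z
  rel : ∀ (A : C) (g : X ⟶ A), F.map g x = 0 ↔ ∃ h : Y ⟶ A, f ≫ h = g

lemma eltPres_of_isRightExactSeq {F : C ⥤ AddCommGrpCat.{v}} {X Y : C}
    {α : preadditiveCoyoneda.obj (op Y) ⟶ preadditiveCoyoneda.obj (op X)}
    {π : preadditiveCoyoneda.obj (op X) ⟶ F} (h : IsRightExactSeq α π) :
    EltPres F (elt α : X ⟶ Y) (elt π) where
  gen A z := by
    obtain ⟨g, hg⟩ := (h A).2 z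
    exact ⟨g, (app_eq π g).symm.trans hg⟩
  rel A g := by
    rw [← app_eq π g]
    refine ((h A).1 g).trans ?_
    constructor
    · rintro ⟨k, hk⟩
      exact ⟨k, (app_eq α k).symm.trans hk⟩
    · rintro ⟨k, hk⟩
      exact ⟨k, (app_eq α k).trans hk⟩

lemma isRightExactSeq_of_eltPres {F : C ⥤ AddCommGrpCat.{v}} [F.Additive] {X Y : C} {f : X ⟶ Y}
    {x : F.obj X} (h : EltPres F f x) :
    IsRightExactSeq (preadditiveCoyoneda.map f.op) (ofElt F x) := by
  intro A
  constructor
  · intro g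
    exact h.rel A g
  · intro z
    exact h.gen A z

lemma finPres_iff (F : C ⥤ AddCommGrpCat.{v}) :
    finPres C F ↔ F.Additive ∧ ∃ (X Y : C) (f : X ⟶ Y) (x : F.obj X), EltPres F f x := by
  constructor
  · rintro ⟨X, Y, α, π, h⟩
    exact ⟨additive_of_surj π (fun A => (h A).2), X, Y, _, _, eltPres_of_isRightExactSeq h⟩
  · rintro ⟨_, X, Y, f, x, h⟩
    exact ⟨X, Y, _, _, isRightExactSeq_of_eltPres h⟩

lemma EltPres.zero {C : Type u} [Category.{v} C] {F : C ⥤ AddCommGrpCat.{v}} {X Y : C} {f : X ⟶ Y} {x : F.obj X}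
    (h : EltPres F f x) {A : C} (k : Y ⟶ A) : F.map (f ≫ k) x = 0 :=
  (h.rel _ _).2 ⟨k, rfl⟩

instance : (finPres C).IsClosedUnderCokernels where
  cokernels_le := by
    rintro _ ⟨α, k, hk, hF, hG⟩
    rename_i F G
    obtain ⟨_, X, Y, f, x, hx⟩ := (finPres_iff F).1 hF
    obtain ⟨_, X', Y', f', x', hx'⟩ := (finPres_iff G).1 hG
    have := Cofork.IsColimit.epi hk
    have hs := surjective_app_of_epi k.π
    obtain ⟨h, hh⟩ := hx'.gen X (α.app X x)
    refine (finPres_iff _).2 ⟨additive_of_surj k.π hs, X', biprod X Y', biprod.lift h f',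
      k.π.app X' x', ?_, ?_⟩
    · intro A z
      obtain ⟨y, rfl⟩ := hs A z
      obtain ⟨g, rfl⟩ := hx'.gen A y
      exact ⟨g, (nat_apply k.π g x').symm⟩
    · intro A g
      rw [← nat_apply]
      refine (exact_app_of_cokernel hk A _).trans ?_
      constructor
      · rintro ⟨y, hy⟩
        obtain ⟨m, rfl⟩ := hx.gen A y
        rw [nat_apply, ← hh, ← map_comp_apply'] at hy
        have : G.map (g - h ≫ m) x' = 0 := by
          rw [map_sub_apply', hy]; exact sub_self _
        obtain ⟨n, hn⟩ := (hx'.rel _ _).1 this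
        refine ⟨biprod.desc m n, ?_⟩
        simp [hn]
      · rintro ⟨l, rfl⟩
        refine ⟨F.map (biprod.inl ≫ l) x, ?_⟩
        rw [nat_apply, ← hh, ← map_comp_apply']
        have e : biprod.lift h f' ≫ l = h ≫ biprod.inl ≫ l + f' ≫ biprod.inr ≫ l := by
          rw [biprod.lift_eq, Preadditive.add_comp, Category.assoc, Category.assoc]
        rw [e, map_add_apply', hx'.zero, add_zero]

set_option maxHeartbeats 400000 in
instance : (finPres C).IsClosedUnderKernels where
  kernels_le := by
    rintro _ ⟨α, k, hk, hF, hG⟩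
    rename_i F G
    obtain ⟨_, X, Y, f, x, hx⟩ := (finPres_iff F).1 hF
    obtain ⟨_, X', Y', f', x', hx'⟩ := (finPres_iff G).1 hG
    have := Fork.IsLimit.mono hk
    have hi := injective_app_of_mono k.ι
    have _ : Functor.Additive k.pt := additive_of_inj k.ι hi
    obtain ⟨h, hh⟩ := hx'.gen X (α.app X x)
    obtain ⟨z, hz⟩ := (exact_app_of_kernel hk (pushout h f') (F.map (pushout.inl h f') x)).1 (by
      rw [nat_apply, ← hh, ← map_comp_apply', pushout.condition, hx'.zero])
    replace hz : k.ι.app (pushout h f') z = F.map (pushout.inl h f') x := hz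
    refine (finPres_iff _).2 ⟨inferInstance, pushout h f', pushout (h ≫ f) f',
      pushout.desc (f ≫ pushout.inl _ _) (pushout.inr _ _) (by
        rw [← Category.assoc, pushout.condition]), z, ?_, ?_⟩
    · intro A y
      obtain ⟨g, hg⟩ := hx.gen A (k.ι.app A y)
      have h1 : α.app A (F.map g x) = 0 := by
        rw [hg]; exact ((exact_app_of_kernel hk A).apply_apply_eq_zero y)
      rw [nat_apply, ← hh, ← map_comp_apply'] at h1
      obtain ⟨n, hn⟩ := (hx'.rel _ _).1 h1
      refine ⟨pushout.desc g n hn.symm, hi _ ?_⟩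
      rw [nat_apply, hz, ← map_comp_apply', pushout.inl_desc, hg]
    · intro A q
      have h1 : k.pt.map q z = 0 ↔ F.map (pushout.inl h f' ≫ q) x = 0 := by
        rw [map_comp_apply', ← hz]
        have e := nat_apply k.ι q z
        rw [← (map_eq_zero_iff _ (hi A))]
        exact Eq.congr_left e
      refine h1.trans ((hx.rel _ _).trans ?_)
      constructor
      · rintro ⟨m, hm⟩
        refine ⟨pushout.desc m (pushout.inr h f' ≫ q) ?_, ?_⟩
        · rw [Category.assoc, hm, ← Category.assoc, pushout.condition, Category.assoc]
        · apply pushout.hom_ext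
          · rw [pushout.inl_desc_assoc, Category.assoc, pushout.inl_desc, hm]
          · rw [pushout.inr_desc_assoc, pushout.inr_desc]
      · rintro ⟨r, rfl⟩
        exact ⟨pushout.inl _ _ ≫ r, by rw [pushout.inl_desc_assoc, Category.assoc]⟩

instance : (finPres C).IsClosedUnderIsomorphisms where
  of_iso {F G} e hF := by
    obtain ⟨X, Y, α, π, h⟩ := hF
    refine ⟨X, Y, α, π ≫ e.hom, fun A => ⟨fun g => ?_, ?_⟩⟩
    · refine Iff.trans ?_ ((h A).1 g)
      exact map_eq_zero_iff (e.hom.app A).hom (injective_app_of_mono e.hom A)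
    · exact (surjective_app_of_epi e.hom A).comp (h A).2

instance : (finPres C).ContainsZero where
  exists_zero := by
    refine ⟨0, isZero_zero _, (finPres_iff _).2 ⟨⟨fun {X Y f g} => ?_⟩, 0, 0, 𝟙 0, 0, ?_, ?_⟩⟩
    · exact (IsZero.obj (isZero_zero _) X).eq_of_src _ _
    · intro A z
      refine ⟨0, ?_⟩
      have := AddCommGrpCat.subsingleton_of_isZero
        (IsZero.obj (isZero_zero (C ⥤ AddCommGrpCat.{v})) A)
      exact Subsingleton.elim _ _
    · intro A g
      exact ⟨fun _ => ⟨g, (isZero_zero C).eq_of_src _ _⟩, fun _ => map_zero _⟩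

lemma finPres_of_biprod {F G B : C ⥤ AddCommGrpCat.{v}} (p : B ⟶ F) (q : B ⟶ G) (i : F ⟶ B)
    (j : G ⟶ B) (hi1 : i ≫ p = 𝟙 F) (hi2 : i ≫ q = 0) (hj1 : j ≫ p = 0) (hj2 : j ≫ q = 𝟙 G)
    (tot : p ≫ i + q ≫ j = 𝟙 B)
    (hF : finPres C F) (hG : finPres C G) : finPres C B := by
  obtain ⟨_, X, Y, f, x, hx⟩ := (finPres_iff F).1 hF
  obtain ⟨_, X', Y', f', x', hx'⟩ := (finPres_iff G).1 hG
  have e1 (A : C) (y : F.obj A) : p.app A (i.app A y) = y :=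
    ConcreteCategory.congr_hom (NatTrans.congr_app hi1 A) y
  have e2 (A : C) (y : F.obj A) : q.app A (i.app A y) = 0 :=
    ConcreteCategory.congr_hom (NatTrans.congr_app hi2 A) y
  have e3 (A : C) (y : G.obj A) : p.app A (j.app A y) = 0 :=
    ConcreteCategory.congr_hom (NatTrans.congr_app hj1 A) y
  have e4 (A : C) (y : G.obj A) : q.app A (j.app A y) = y :=
    ConcreteCategory.congr_hom (NatTrans.congr_app hj2 A) y
  have e5 (A : C) (y : B.obj A) : i.app A (p.app A y) + j.app A (q.app A y) = y :=
    ConcreteCategory.congr_hom (NatTrans.congr_app tot A) y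
  have e6 (A : C) (y : B.obj A) : y = 0 ↔ p.app A y = 0 ∧ q.app A y = 0 := by
    constructor
    · rintro rfl; simp
    · rintro ⟨h1, h2⟩
      rw [← e5 A y, h1, h2]; simp
  have hadd : B.Additive :=
    additive_of_jointly_injective p q (fun A y h1 h2 => (e6 A y).2 ⟨h1, h2⟩)
  have key (A : C) (g : X ⟶ A) (g' : X' ⟶ A) :
      B.map (biprod.desc g g') (i.app _ (F.map biprod.inl x) + j.app _ (G.map biprod.inr x'))
        = i.app _ (F.map g x) + j.app _ (G.map g' x') := by
    rw [map_add, ← nat_apply, ← nat_apply, ← map_comp_apply', ← map_comp_apply',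
      biprod.inl_desc, biprod.inr_desc]
  refine (finPres_iff _).2 ⟨hadd, biprod X X', biprod Y Y', biprod.map f f',
    i.app _ (F.map biprod.inl x) + j.app _ (G.map biprod.inr x'), ?_, ?_⟩
  · intro A z
    obtain ⟨g, hg⟩ := hx.gen A (p.app A z)
    obtain ⟨g', hg'⟩ := hx'.gen A (q.app A z)
    exact ⟨biprod.desc g g', by rw [key, hg, hg', e5]⟩
  · intro A t
    have ht : t = biprod.desc (biprod.inl ≫ t) (biprod.inr ≫ t) := by
      apply biprod.hom_ext' <;> simp
    rw [ht, key, e6]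
    simp only [map_add, e1, e2, e3, e4, add_zero, zero_add]
    rw [hx.rel, hx'.rel]
    constructor
    · rintro ⟨⟨m, hm⟩, n, hn⟩
      refine ⟨biprod.desc m n, ?_⟩
      apply biprod.hom_ext' <;> simp [hm, hn]
    · rintro ⟨r, hr⟩
      refine ⟨⟨biprod.inl ≫ r, ?_⟩, biprod.inr ≫ r, ?_⟩
      · rw [← biprod.inl_map_assoc, hr, biprod.inl_desc]
      · rw [← biprod.inr_map_assoc, hr, biprod.inr_desc]

instance : (finPres C).IsClosedUnderBinaryProducts where
  limitsOfShape_le := by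
    rintro B ⟨p, hp⟩
    have hB := (IsLimit.postcomposeHomEquiv (diagramIsoPair p.diag) p.cone).symm p.isLimit
    have hb := binaryBiconeIsBilimitOfLimitConeOfIsLimit hB
    let t := BinaryBicone.ofLimitCone hB
    exact finPres_of_biprod t.fst t.snd t.inl t.inr t.inl_fst t.inl_snd t.inr_fst t.inr_snd
      (IsBilimit.binary_total hb) (hp _) (hp _)

instance : (finPres C).IsClosedUnderFiniteProducts := ObjectProperty.IsClosedUnderFiniteProducts.mk'

variable (C) in
/-- The category of finitely presented functors `C ⥤ Ab`. -/
abbrev FP := (finPres C).FullSubcategory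

instance (F : FP C) : F.obj.Additive := ((finPres_iff F.obj).1 F.property).1

lemma finPres_repr (X : C) : finPres C (preadditiveCoyoneda.obj (op X)) := by
  refine (finPres_iff _).2 ⟨inferInstance, X, 0, 0, (𝟙 X : X ⟶ X), ?_, ?_⟩
  · intro A z
    exact ⟨z, Category.id_comp (z : X ⟶ A)⟩
  · intro A g
    have e : (preadditiveCoyoneda.obj (op X)).map g (𝟙 X : X ⟶ X) = g :=
      Category.id_comp (g : X ⟶ A)
    constructor
    · intro h
      exact ⟨0, by rw [zero_comp]; exact h.symm.trans e⟩
    · rintro ⟨h, hh⟩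
      rw [zero_comp] at hh
      subst hh
      exact e

variable (C) in
/-- The contravariant Yoneda embedding `X ↦ (X, -)`. -/
noncomputable def yon : Cᵒᵖ ⥤ FP C :=
  (finPres C).lift preadditiveCoyoneda (fun X => finPres_repr X.unop)

instance : (yon C).Additive where
  map_add {X Y f g} := by
    ext A h
    exact Preadditive.add_comp _ _ _ f.unop g.unop (h : X.unop ⟶ A)

lemma surjective_of_epi_FP {F G : FP C} (f : F ⟶ G) [Epi f] (A : C) :
    Function.Surjective (f.hom.app A) := by
  have := (finPres C).preservesEpimorphisms_ι_of_isNormalMonoCategory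
  have : Epi f.hom := inferInstanceAs (Epi ((finPres C).ι.map f))
  exact surjective_app_of_epi f.hom A

lemma hom_ext_elt {F : C ⥤ AddCommGrpCat.{v}} {X : C}
    {π π' : preadditiveCoyoneda.obj (op X) ⟶ F} (h : elt π = elt π') : π = π' := by
  ext A g
  exact (app_eq π (g : X ⟶ A)).trans ((congrArg _ h).trans (app_eq π' (g : X ⟶ A)).symm)

instance (X : Cᵒᵖ) : Projective ((yon C).obj X) where
  factors {G H} f e _ := by
    obtain ⟨y, hy⟩ := surjective_of_epi_FP e X.unop (elt f.hom)
    refine ⟨ObjectProperty.homMk (ofElt G.obj y), ?_⟩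
    ext : 1
    apply hom_ext_elt
    refine Eq.trans ?_ hy
    exact congrArg (e.hom.app X.unop) (elt_ofElt G.obj y)

instance : EnoughProjectives (FP C) where
  presentation F := by
    obtain ⟨X, Y, α, π, h⟩ := F.property
    let p : (yon C).obj (op X) ⟶ F := ObjectProperty.homMk π
    have h1 : ∀ A, Epi (π.app A) := fun A => (AddCommGrpCat.epi_iff_surjective _).2 (h A).2
    have h2 : Epi π := NatTrans.epi_of_epi_app π
    have h3 : Epi ((finPres C).ι.map p) := h2
    have : Epi p := (finPres C).ι.epi_of_epi_map h3
    exact ⟨{ p := (yon C).obj (op X), f := p }⟩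

lemma EltPres.exists_hom {F : C ⥤ AddCommGrpCat.{v}} [F.Additive] {X Y : C} {f : X ⟶ Y}
    {x : F.obj X} (hx : EltPres F f x) (G : C ⥤ AddCommGrpCat.{v}) [G.Additive] (y : G.obj X)
    (hy : G.map f y = 0) : ∃ α : F ⟶ G, α.app X x = y := by
  choose s hs using hx.gen
  have wd (A : C) (g h : X ⟶ A) (e : F.map g x = F.map h x) : G.map g y = G.map h y := by
    rw [← sub_eq_zero, ← map_sub_apply', hx.rel] at e
    obtain ⟨k, hk⟩ := e
    rw [← sub_eq_zero, ← map_sub_apply', ← hk, map_comp_apply', hy, map_zero]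
  refine ⟨{ app A := AddCommGrpCat.ofHom (AddMonoidHom.mk' (fun z => G.map (s A z) y) ?_),
            naturality A B k := ?_ }, ?_⟩
  · intro z z'
    rw [← map_add_apply']
    apply wd
    rw [map_add_apply', hs, hs, hs]
  · ext z
    change G.map (s B (F.map k z)) y = G.map k (G.map (s A z) y)
    rw [← map_comp_apply']
    apply wd
    rw [hs, map_comp_apply', hs]
  · change G.map (s X x) y = y
    refine (wd _ _ (𝟙 X) ?_).trans ?_
    · rw [hs]; simp
    · simp

lemma EltPres.hom_ext {C : Type u} [Category.{v} C] {F G : C ⥤ AddCommGrpCat.{v}} {X Y : C} {f : X ⟶ Y}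
    {x : F.obj X} (hx : EltPres F f x) {α β : F ⟶ G} (h : α.app X x = β.app X x) : α = β := by
  ext A z
  obtain ⟨g, rfl⟩ := hx.gen A z
  rw [nat_apply, nat_apply, h]

instance : (yon C).IsRightAdjoint := by
  rw [isRightAdjoint_iff_hasInitial_structuredArrow]
  intro F
  obtain ⟨_, X, Y, f, x, hx⟩ := (finPres_iff F.obj).1 F.property
  obtain ⟨η, hη⟩ := hx.exists_hom (preadditiveCoyoneda.obj (op (kernel f)))
    (kernel.ι f : kernel f ⟶ X) (kernel.condition f)
  let T : StructuredArrow F (yon C) :=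
    StructuredArrow.mk (Y := op (kernel f)) (ObjectProperty.homMk η : F ⟶ (yon C).obj _)
  have key (Z : C) (θ : F ⟶ (yon C).obj (op Z)) (l : Z ⟶ kernel f) :
      ((ObjectProperty.homMk η : F ⟶ (yon C).obj (op (kernel f))) ≫ (yon C).map l.op = θ) ↔
        l ≫ kernel.ι f = (θ.hom.app X x : Z ⟶ X) := by
    have e : (preadditiveCoyoneda.map l.op).app X (η.app X x) = l ≫ kernel.ι f := by
      rw [hη]; rfl
    constructor
    · rintro rfl
      exact e.symm
    · intro h
      ext : 1
      apply hx.hom_ext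
      exact e.trans h
  have ex (Z : C) (θ : F ⟶ (yon C).obj (op Z)) : (θ.hom.app X x : Z ⟶ X) ≫ f = 0 := by
    have := nat_apply θ.hom f x
    refine Eq.trans this.symm ?_
    have h0 : F.obj.map f x = 0 := (hx.rel _ _).2 ⟨𝟙 _, Category.comp_id _⟩
    rw [h0, map_zero]
    rfl
  refine IsInitial.hasInitial (X := T) (IsInitial.ofUniqueHom (fun S => ?_) ?_)
  · exact StructuredArrow.homMk
      (kernel.lift f (S.hom.hom.app X x : S.right.unop ⟶ X) (ex S.right.unop S.hom)).op
      ((key S.right.unop S.hom _).2 (kernel.lift_ι _ _ _))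
  · intro S m
    have h := (key S.right.unop S.hom m.right.unop).1 (StructuredArrow.w m)
    apply StructuredArrow.hom_ext
    apply Quiver.Hom.unop_inj
    rw [← cancel_mono (kernel.ι f), h]
    exact (kernel.lift_ι _ _ _).symm

variable (C) in
/-- The left adjoint of the Yoneda embedding. -/
noncomputable def w : FP C ⥤ Cᵒᵖ := (yon C).leftAdjoint

instance : (w C).Additive :=
  (Adjunction.ofIsRightAdjoint (yon C)).left_adjoint_additive

end FinPres

section AdditiveFunctors

variable {D : Type u} [Category.{v} D] [Preadditive D]

instance : (additiveFunctor D AddCommGrpCat.{v}).IsClosedUnderCokernels where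
  cokernels_le := by
    rintro _ ⟨α, k, hk, hF, hG⟩
    have := Cofork.IsColimit.epi hk
    have _ : Functor.Additive _ := hG
    exact additive_of_surj k.π (surjective_app_of_epi k.π)

instance : (additiveFunctor D AddCommGrpCat.{v}).IsClosedUnderKernels where
  kernels_le := by
    rintro _ ⟨α, k, hk, hF, hG⟩
    have := Fork.IsLimit.mono hk
    have _ : Functor.Additive _ := hF
    exact additive_of_inj k.ι (injective_app_of_mono k.ι)

instance : (additiveFunctor D AddCommGrpCat.{v}).IsClosedUnderIsomorphisms where
  of_iso {F G} e hF := by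
    have _ : F.Additive := hF
    exact additive_of_surj e.hom (surjective_app_of_epi e.hom)

instance : (additiveFunctor D AddCommGrpCat.{v}).ContainsZero where
  exists_zero := ⟨0, isZero_zero _, ⟨(IsZero.obj (isZero_zero _) _).eq_of_src _ _⟩⟩

instance : (additiveFunctor D AddCommGrpCat.{v}).IsClosedUnderBinaryProducts where
  limitsOfShape_le := by
    rintro B ⟨p, hp⟩
    have hB := (IsLimit.postcomposeHomEquiv (diagramIsoPair p.diag) p.cone).symm p.isLimit
    have hb := binaryBiconeIsBilimitOfLimitConeOfIsLimit hB
    let t := BinaryBicone.ofLimitCone hB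
    have _ : Functor.Additive _ := hp ⟨WalkingPair.left⟩
    have _ : Functor.Additive _ := hp ⟨WalkingPair.right⟩
    refine additive_of_jointly_injective t.fst t.snd (fun A y h1 h2 => ?_)
    have e : t.inl.app A (t.fst.app A y) + t.inr.app A (t.snd.app A y) = y :=
      ConcreteCategory.congr_hom (NatTrans.congr_app (IsBilimit.binary_total hb) A) y
    have e1 : t.inl.app A (t.fst.app A y) = 0 := (congrArg (t.inl.app A) h1).trans (map_zero _)
    have e2 : t.inr.app A (t.snd.app A y) = 0 := (congrArg (t.inr.app A) h2).trans (map_zero _)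
    exact e.symm.trans ((congrArg₂ (· + ·) e1 e2).trans (add_zero _))

instance : (additiveFunctor D AddCommGrpCat.{v}).IsClosedUnderFiniteProducts :=
  ObjectProperty.IsClosedUnderFiniteProducts.mk'

lemma injective_of_mono_additive {F G : D ⥤+ AddCommGrpCat.{v}} (f : F ⟶ G) [Mono f] (A : D) :
    Function.Injective (f.hom.app A) := by
  have := (additiveFunctor D AddCommGrpCat.{v}).preservesMonomorphisms_ι_of_isNormalEpiCategory
  have : Mono f.hom :=
    inferInstanceAs (Mono ((additiveFunctor D AddCommGrpCat.{v}).ι.map f))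
  exact injective_app_of_mono f.hom A

/-- The additive functor `A ↦ ∏ i, Hom_ℤ (Hom (A, B i), M i)`. -/
def coind {I : Type v} (B : I → D) (M : I → AddCommGrpCat.{v}) : D ⥤ AddCommGrpCat.{v} where
  obj A := AddCommGrpCat.of (∀ i, (A ⟶ B i) →+ M i)
  map {A A'} f := AddCommGrpCat.ofHom
    (AddMonoidHom.mk' (fun φ i => (φ i).comp (Preadditive.leftComp (B i) f)) (fun _ _ => rfl))
  map_id A := by
    ext φ i g
    exact congrArg ((φ : ∀ i, (A ⟶ B i) →+ M i) i) (Category.id_comp g)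
  map_comp {A _ _} f g := by
    ext φ i h
    exact congrArg ((φ : ∀ i, (A ⟶ B i) →+ M i) i) (Category.assoc f g h)

instance {I : Type v} (B : I → D) (M : I → AddCommGrpCat.{v}) : (coind B M).Additive where
  map_add {A A' f g} := by
    ext φ
    funext i
    ext h
    change φ i ((f + g) ≫ h) = φ i (f ≫ h) + φ i (g ≫ h)
    rw [Preadditive.add_comp, map_add]

/-- The natural transformation `F ⟶ coind B M` given by homomorphisms `F (B i) → M i`. -/
def toCoind {I : Type v} (B : I → D) (M : I → AddCommGrpCat.{v}) (F : D ⥤ AddCommGrpCat.{v})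
    [F.Additive] (ψ : ∀ i, F.obj (B i) ⟶ M i) : F ⟶ coind B M where
  app A := AddCommGrpCat.ofHom (AddMonoidHom.mk'
    (fun y i => AddMonoidHom.mk' (fun u => ψ i (F.map u y))
      (fun u u' => by rw [map_add_apply', map_add]))
    (fun y y' => by
      funext i
      ext u
      change ψ i (F.map u (y + y')) = ψ i (F.map u y) + ψ i (F.map u y')
      rw [map_add, map_add]))
  naturality A A' k := by
    ext y
    funext i
    ext u
    change ψ i (F.map u (F.map k y)) = ψ i (F.map (k ≫ u) y)
    rw [map_comp_apply']

instance {I : Type v} (B : I → D) (M : I → AddCommGrpCat.{v}) [∀ i, Injective (M i)] :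
    Injective (AdditiveFunctor.of (coind B M)) where
  factors {F G} φ m _ := by
    let φ' (i : I) : F.obj.obj (B i) ⟶ M i := AddCommGrpCat.ofHom
      (AddMonoidHom.mk' (fun x => (φ.hom.app (B i) x : ∀ i, (_ ⟶ B i) →+ M i) i (𝟙 (B i)))
        (fun x y => by rw [map_add]; rfl))
    have hm (i : I) : Mono (m.hom.app (B i)) :=
      (AddCommGrpCat.mono_iff_injective _).2 (injective_of_mono_additive m (B i))
    let ψ (i : I) : G.obj.obj (B i) ⟶ M i := Injective.factorThru (φ' i) (m.hom.app (B i))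
    have hψ (i : I) (x : F.obj.obj (B i)) : ψ i (m.hom.app (B i) x) = φ' i x :=
      ConcreteCategory.congr_hom (Injective.comp_factorThru (φ' i) (m.hom.app (B i))) x
    refine ⟨ObjectProperty.homMk (toCoind B M G.obj ψ), ?_⟩
    ext A x
    funext i
    ext u
    change ψ i (G.obj.map u (m.hom.app A x)) = (φ.hom.app A x : ∀ i, (A ⟶ B i) →+ M i) i u
    rw [← nat_apply, hψ]
    change (φ.hom.app (B i) (F.obj.map u x) : ∀ i, (_ ⟶ B i) →+ M i) i (𝟙 (B i)) = _
    rw [nat_apply]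
    exact congrArg ((φ.hom.app A x : ∀ i, (A ⟶ B i) →+ M i) i) (Category.comp_id u)

instance [EssentiallySmall.{v} D] : EnoughInjectives (D ⥤+ AddCommGrpCat.{v}) where
  presentation F := by
    let B : SmallModel.{v} D → D := (equivSmallModel D).inverse.obj
    let M (i : SmallModel.{v} D) : AddCommGrpCat.{v} := Injective.under (F.obj.obj (B i))
    let f : F ⟶ AdditiveFunctor.of (coind B M) :=
      ObjectProperty.homMk (toCoind B M F.obj (fun i => Injective.ι _))
    have h1 (A : D) : Mono (f.hom.app A) := by
      rw [AddCommGrpCat.mono_iff_injective, injective_iff_map_eq_zero]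
      intro y hy
      let i := (equivSmallModel D).functor.obj A
      let u : A ⟶ B i := (equivSmallModel D).unit.app A
      have h : (Injective.ι (F.obj.obj (B i))) (F.obj.map u y) = 0 :=
        DFunLike.congr_fun (congrFun (show (f.hom.app A y : ∀ i, (A ⟶ B i) →+ M i) = 0 from hy) i) u
      have hi : Function.Injective (Injective.ι (F.obj.obj (B i))) :=
        (AddCommGrpCat.mono_iff_injective _).1 inferInstance
      have hu : Function.Injective (F.obj.map u) :=
        (AddCommGrpCat.mono_iff_injective _).1 inferInstance
      exact hu (hi (h.trans (by rw [map_zero, map_zero])))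
    have h2 : Mono f.hom := NatTrans.mono_of_mono_app _
    have h3 : Mono ((additiveFunctor D AddCommGrpCat.{v}).ι.map f) := h2
    have : Mono f := (additiveFunctor D AddCommGrpCat.{v}).ι.mono_of_mono_map h3
    exact ⟨{ J := AdditiveFunctor.of (coind B M), f := f }⟩

end AdditiveFunctors

section Tensor

variable (R : Type u) [Ring R]

/-- Finitely presented left `R`-modules. -/
def fpModules : ObjectProperty (ModuleCat.{u} R) := fun L => Module.FinitePresentation R L

/-- The category `mod(Rᵒᵖ)` of finitely presented left `R`-modules. -/
abbrev FPMod := (fpModules R).FullSubcategory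

/-- The category `(mod(Rᵒᵖ), Ab)` of additive functors. -/
abbrev AddFun := FPMod R ⥤+ AddCommGrpCat.{u}

instance : EssentiallySmall.{u} (FPMod R) := by
  have h : fpModules R ≤ ModuleCat.isFG R := fun L (hL : Module.FinitePresentation R L) =>
    (inferInstance : Module.Finite R L)
  exact essentiallySmall_of_fully_faithful (ObjectProperty.ιOfLE h)

section

variable (X : Type u) [AddCommGroup X] [Module Rᵐᵒᵖ X] (L : Type u) [AddCommGroup L] [Module R L]

/-- The subgroup of `X ⊗ℤ L` generated by the elements `xr ⊗ l - x ⊗ rl`. -/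
def balancedRelations : AddSubgroup (X ⊗[ℤ] L) :=
  AddSubgroup.closure
    {z | ∃ (x : X) (r : R) (l : L), z = (MulOpposite.op r • x) ⊗ₜ[ℤ] l - x ⊗ₜ[ℤ] (r • l)}

/-- The tensor product `X ⊗_R L` of a right module and a left module. -/
abbrev BalancedTensor : Type u := (X ⊗[ℤ] L) ⧸ balancedRelations R X L

variable {R X L}
variable {X' : Type u} [AddCommGroup X'] [Module Rᵐᵒᵖ X'] {L' : Type u} [AddCommGroup L']
  [Module R L']

/-- The homomorphism `f ⊗_R g`. -/
def BalancedTensor.map (f : X →ₗ[Rᵐᵒᵖ] X') (g : L →ₗ[R] L') :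
    BalancedTensor R X L →+ BalancedTensor R X' L' :=
  QuotientAddGroup.map _ _
    (TensorProduct.map f.toAddMonoidHom.toIntLinearMap g.toAddMonoidHom.toIntLinearMap).toAddMonoidHom
    (by
      rw [balancedRelations, AddSubgroup.closure_le]
      rintro _ ⟨x, r, l, rfl⟩
      refine AddSubgroup.subset_closure ⟨f x, r, g l, ?_⟩
      simp)

/-- The class of `x ⊗ l` in `X ⊗_R L`. -/
def BalancedTensor.tmul (x : X) (l : L) : BalancedTensor R X L :=
  QuotientAddGroup.mk (x ⊗ₜ[ℤ] l)

lemma BalancedTensor.map_tmul (f : X →ₗ[Rᵐᵒᵖ] X') (g : L →ₗ[R] L') (x : X) (l : L) :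
    BalancedTensor.map f g (.tmul x l) = .tmul (f x) (g l) := rfl

lemma BalancedTensor.hom_ext {A : Type*} [AddMonoid A] {φ ψ : BalancedTensor R X L →+ A}
    (h : ∀ (x : X) (l : L), φ (.tmul x l) = ψ (.tmul x l)) : φ = ψ := by
  refine QuotientAddGroup.addMonoidHom_ext _ ?_
  ext z
  induction z using TensorProduct.induction_on with
  | zero => simp
  | tmul x l => exact h x l
  | add a b ha hb => rw [map_add, map_add, ha, hb]

lemma BalancedTensor.add_tmul (x y : X) (l : L) :
    (BalancedTensor.tmul (x + y) l : BalancedTensor R X L) = .tmul x l + .tmul y l := by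
  unfold tmul
  rw [TensorProduct.add_tmul]; rfl

lemma BalancedTensor.tmul_add (x : X) (k l : L) :
    (BalancedTensor.tmul x (k + l) : BalancedTensor R X L) = .tmul x k + .tmul x l := by
  unfold tmul
  rw [TensorProduct.tmul_add]; rfl

end

/-- The functor `X ⊗_R -` on finitely presented left modules. -/
def tensorFunctor (X : ModuleCat.{u} Rᵐᵒᵖ) : FPMod R ⥤ AddCommGrpCat.{u} where
  obj L := AddCommGrpCat.of (BalancedTensor R X L.obj)
  map g := AddCommGrpCat.ofHom (BalancedTensor.map LinearMap.id g.hom.hom)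
  map_id _ := AddCommGrpCat.hom_ext (BalancedTensor.hom_ext (fun _ _ => rfl))
  map_comp _ _ := AddCommGrpCat.hom_ext (BalancedTensor.hom_ext (fun _ _ => rfl))

instance (X : ModuleCat.{u} Rᵐᵒᵖ) : (tensorFunctor R X).Additive where
  map_add := AddCommGrpCat.hom_ext (BalancedTensor.hom_ext (fun _ _ => BalancedTensor.tmul_add _ _ _))

/-- The tensor embedding `X ↦ X ⊗_R -`. -/
def tensorEmbedding : ModuleCat.{u} Rᵐᵒᵖ ⥤ AddFun R where
  obj X := AdditiveFunctor.of (tensorFunctor R X)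
  map f := ObjectProperty.homMk
    { app L := AddCommGrpCat.ofHom (BalancedTensor.map f.hom LinearMap.id)
      naturality _ _ _ := AddCommGrpCat.hom_ext (BalancedTensor.hom_ext (fun _ _ => rfl)) }
  map_id X := by
    ext L : 3
    exact AddCommGrpCat.hom_ext (BalancedTensor.hom_ext (fun _ _ => rfl))
  map_comp f g := by
    ext L : 3
    exact AddCommGrpCat.hom_ext (BalancedTensor.hom_ext (fun _ _ => rfl))

instance : (tensorEmbedding R).Additive where
  map_add {X Y f g} := by
    ext L : 3
    exact AddCommGrpCat.hom_ext
      (BalancedTensor.hom_ext (fun _ _ => BalancedTensor.add_tmul _ _ _))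

/-- The ring `R` as a finitely presented left module. -/
def regular : FPMod R := ⟨ModuleCat.of R R, inferInstanceAs (Module.FinitePresentation R R)⟩

/-- Right multiplication by `r` as an endomorphism of the left module `R`. -/
def rightMul (r : R) : regular R ⟶ regular R :=
  ObjectProperty.homMk (ModuleCat.ofHom (LinearMap.toSpanSingleton R R r))

lemma rightMul_hom (r s : R) : (rightMul R r).hom.hom (s : R) = s * r := rfl

/-- The action of `Rᵐᵒᵖ` on `G(R)`: the scalar `op r` acts as `G(· * r)`. -/
def evAction (G : AddFun R) : Rᵐᵒᵖ →+* End (G.obj.obj (regular R)) where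
  toFun r := G.obj.map (rightMul R r.unop)
  map_one' := by
    have : rightMul R 1 = 𝟙 _ := ObjectProperty.hom_ext _
      (ModuleCat.hom_ext (LinearMap.ext fun (s : R) => mul_one s))
    exact (congrArg G.obj.map this).trans (G.obj.map_id _)
  map_mul' r s := by
    have : rightMul R (r * s).unop = rightMul R s.unop ≫ rightMul R r.unop := ObjectProperty.hom_ext _
      (ModuleCat.hom_ext (LinearMap.ext fun (t : R) => (mul_assoc t s.unop r.unop).symm))
    exact (congrArg G.obj.map this).trans (G.obj.map_comp _ _)
  map_zero' := by
    have : rightMul R 0 = 0 := ObjectProperty.hom_ext _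
      (ModuleCat.hom_ext (LinearMap.ext fun (s : R) => mul_zero s))
    exact (congrArg G.obj.map this).trans (G.obj.map_zero _ _)
  map_add' r s := by
    have : rightMul R (r + s).unop = rightMul R r.unop + rightMul R s.unop := ObjectProperty.hom_ext _
      (ModuleCat.hom_ext (LinearMap.ext fun (t : R) => mul_add t r.unop s.unop))
    exact (congrArg G.obj.map this).trans G.obj.map_add

/-- Evaluation at `R`: the right module `G(R)`. -/
def evR : AddFun R ⥤ ModuleCat.{u} Rᵐᵒᵖ where
  obj G := ModuleCat.mkOfSMul (evAction R G)
  map α := ModuleCat.ofHom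
    { toFun := fun x => α.hom.app (regular R) x
      map_add' := fun x y => map_add (α.hom.app (regular R)).hom x y
      map_smul' := fun r x => nat_apply α.hom (rightMul R r.unop) x }
  map_id _ := rfl
  map_comp _ _ := rfl

instance : (evR R).Additive where
  map_add := rfl

/-- Finitely presented functors `Mod(R) → Ab`, with `Mod(R)` the category of right modules. -/
abbrev FPFun := FP (ModuleCat.{u} Rᵐᵒᵖ)

/-- The Auslander–Gruson–Jensen functor `D_A = R₀(t ∘ w)`, as a covariant functor to the
opposite category. -/
noncomputable def DA : FPFun R ⥤ (AddFun R)ᵒᵖ :=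
  (w (ModuleCat.{u} Rᵐᵒᵖ) ⋙ (tensorEmbedding R).op).leftDerived 0

/-- The functor `D_L = L⁰(Y ∘ ev_R)`. -/
noncomputable def DL : (AddFun R)ᵒᵖ ⥤ FPFun R :=
  ((evR R).op ⋙ yon (ModuleCat.{u} Rᵐᵒᵖ)).leftDerived 0

/-- Pure exact sequences of right modules. -/
def IsPureExact (S : ShortComplex (ModuleCat.{u} Rᵐᵒᵖ)) : Prop :=
  S.ShortExact ∧ (S.map (tensorEmbedding R)).ShortExact

/-- `F` arises from a pure exact sequence `0 → X → Y → Z → 0`: there is an exact sequence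
`0 ⟶ (Z, -) ⟶ (Y, -) ⟶ (X, -) ⟶ F ⟶ 0`. -/
def ArisesFromPureExact (F : FPFun R) : Prop :=
  ∃ S : ShortComplex (ModuleCat.{u} Rᵐᵒᵖ), IsPureExact R S ∧
    (∀ A, Function.Injective ((preadditiveCoyoneda.map S.g.op).app A)) ∧
    (∀ A, Function.Exact ((preadditiveCoyoneda.map S.g.op).app A)
      ((preadditiveCoyoneda.map S.f.op).app A)) ∧
    ∃ π : preadditiveCoyoneda.obj (op S.X₁) ⟶ F.obj,
      IsRightExactSeq (preadditiveCoyoneda.map S.f.op) π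

end Tensor
end AGJ

/-! The theorem reduces to one fact: viewed as functors between `FPFun R` and `(AddFun R)ᵒᵖ`, `DL R`
is left adjoint to `DA R` and the unit is invertible (`exists_adjunction`). Being a zeroth derived
functor, `DA R` is right exact; being a right adjoint, it is left exact. Since its left adjoint is
fully faithful, it is a localization at the morphisms it inverts, and by exactness these are the
morphisms whose kernel and cokernel it kills. The counit is among them, so an exact `E` vanishing on
the kernel inverts it, which gives `E D_L D_A ≅ E`; exactness of `E D_L` descends along the
localization, and uniqueness follows by composing with the invertible unit.

The adjunction comes from a general criterion, `exists_adjunction_leftDerived`: a right exact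
functor whose left adjoint is known on projectives, with invertible unit there, has a left adjoint
everywhere, namely the zeroth derived functor. Projectives of `(AddFun R)ᵒᵖ` are injective functors
`I`. Such an `I` is right exact on finitely presented modules, so `I(R) ⊗_R - ≅ I`
(`isIso_tensorCounit_of_injective`). For maps into `D_A` of a representable, the universal property
is the adjunction between `t` and `ev_R`; it extends to all finitely presented functors by
projectivity (`bijective_comp_map_of_projective`).

For the kernel, present `F` by `f : X ⟶ Y`. Then `D_A F` is the kernel of `t f` in `AddFun R`, so it
vanishes exactly when `t f` is mono; evaluation at `R` then shows that `f` is mono, and its cokernel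
sequence is pure exact. -/

namespace AGJ

/-! ### Right exactness of the zeroth left derived functor. -/

section RightExact

variable {C : Type*} [Category* C] [Abelian C] {D : Type*} [Category* D] [Abelian D]

lemma exact_comp_kernel_ι {Q P X : C} (p : P ⟶ X) (q : Q ⟶ kernel p) [Epi q] :
    (ShortComplex.mk (q ≫ kernel.ι p) p (by simp)).Exact := by
  rw [ShortComplex.exact_iff_epi_kernel_lift]
  have : kernel.lift p (q ≫ kernel.ι p) (by simp) = q := by
    rw [← cancel_mono (kernel.ι p), kernel.lift_ι]
  change Epi (kernel.lift p (q ≫ kernel.ι p) (by simp))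
  rw [this]
  infer_instance

section

/-- The augmentation `P₀ ⟶ X` of a projective resolution. -/
noncomputable def augmentation {X : C} (P : ProjectiveResolution X) : P.complex.X 0 ⟶ X := P.π.f 0

instance {X : C} (P : ProjectiveResolution X) : Epi (augmentation P) :=
  inferInstanceAs (Epi (P.π.f 0))

lemma d_comp_augmentation {X : C} (P : ProjectiveResolution X) :
    P.complex.d 1 0 ≫ augmentation P = 0 := P.complex_d_comp_π_f_zero

variable [HasProjectiveResolutions C] (F : C ⥤ D) [F.Additive]

/-- `(F.leftDerived 0).obj X` as the zeroth opcycles of a resolution. -/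
noncomputable def leftDerivedIsoOpcycles {X : C} (P : ProjectiveResolution X) :
    (F.leftDerived 0).obj X ≅ ((F.mapHomologicalComplex _).obj P.complex).opcycles 0 :=
  P.isoLeftDerivedObj F 0 ≪≫ ChainComplex.isoHomologyι₀ _

/-- The projection to the zeroth opcycles of a resolution. -/
noncomputable def toOpcycles {X : C} (P : ProjectiveResolution X) :
    F.obj (P.complex.X 0) ⟶ ((F.mapHomologicalComplex _).obj P.complex).opcycles 0 :=
  ((F.mapHomologicalComplex _).obj P.complex).pOpcycles 0

instance {X : C} (P : ProjectiveResolution X) : Epi (toOpcycles F P) :=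
  inferInstanceAs (Epi (((F.mapHomologicalComplex _).obj P.complex).pOpcycles 0))

instance {X : C} (P : ProjectiveResolution X) (n : ℕ) : Projective (P.complex.X n) :=
  P.projective n

lemma leftDerivedIsoOpcycles_naturality {X Y : C} (f : X ⟶ Y) (P : ProjectiveResolution X)
    (Q : ProjectiveResolution Y) (φ : P.complex ⟶ Q.complex)
    (comm : φ.f 0 ≫ Q.π.f 0 = P.π.f 0 ≫ f) :
    (F.leftDerived 0).map f ≫ (leftDerivedIsoOpcycles F Q).hom =
      (leftDerivedIsoOpcycles F P).hom ≫
        HomologicalComplex.opcyclesMap ((F.mapHomologicalComplex _).map φ) 0 := by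
  have h := P.isoLeftDerivedObj_hom_naturality f Q φ comm F 0
  refine (Category.assoc _ _ _).symm.trans
    ((congrArg (· ≫ (ChainComplex.isoHomologyι₀ _).hom) h).trans ?_)
  exact (Category.assoc _ _ _).trans ((congrArg ((P.isoLeftDerivedObj F 0).hom ≫ ·)
    (HomologicalComplex.homologyι_naturality _ _)).trans (Category.assoc _ _ _).symm)

/-- This identifies `L₀F(P₀) ⟶ L₀F(X)` with the canonical projection from `F(P₀)`, so that the
universal property of opcycles can be used for `L₀F(X)`. -/
lemma leftDerived_map_π_comp {X : C} (P : ProjectiveResolution X) :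
    (F.leftDerived 0).map (augmentation P) ≫ (leftDerivedIsoOpcycles F P).hom =
      F.fromLeftDerivedZero.app (P.complex.X 0) ≫ toOpcycles F P := by
  let P₀ := P.complex.X 0
  -- The augmentation is lifted to a chain map from the trivial resolution of `P₀`; in degree zero
  -- the lift is the identity.
  let S := ProjectiveResolution.self P₀
  let φ : S.complex ⟶ P.complex := (ChainComplex.fromSingle₀Equiv P.complex P₀).symm (𝟙 P₀)
  have hφ : φ.f 0 = 𝟙 P₀ := ChainComplex.fromSingle₀Equiv_symm_apply_f_zero (𝟙 P₀)
  have hπ : S.π.f 0 = 𝟙 P₀ := rfl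
  let ρ : ((F.mapHomologicalComplex _).obj S.complex).opcycles 0 ⟶ F.obj P₀ :=
    S.fromLeftDerivedZero' F
  let q : F.obj P₀ ⟶ ((F.mapHomologicalComplex _).obj S.complex).opcycles 0 := toOpcycles F S
  have h2 : q ≫ ρ = 𝟙 _ := (S.pOpcycles_comp_fromLeftDerivedZero' F).trans (F.map_id P₀)
  have hρ : IsIso ρ := inferInstanceAs (IsIso (S.fromLeftDerivedZero' F))
  have h3 : ρ ≫ q = 𝟙 _ := by
    rw [← cancel_mono ρ, Category.assoc, h2, Category.comp_id, Category.id_comp]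
  have h4 : q ≫ HomologicalComplex.opcyclesMap ((F.mapHomologicalComplex _).map φ) 0 =
      toOpcycles F P :=
    (HomologicalComplex.p_opcyclesMap _ _).trans ((congrArg (· ≫ toOpcycles F P)
      ((congrArg F.map hφ).trans (F.map_id P₀))).trans (Category.id_comp _))
  have h5 : HomologicalComplex.opcyclesMap ((F.mapHomologicalComplex _).map φ) 0 =
      ρ ≫ toOpcycles F P := by
    rw [← h4, ← Category.assoc, h3, Category.id_comp]
  have h6 : F.fromLeftDerivedZero.app P₀ = (leftDerivedIsoOpcycles F S).hom ≫ ρ :=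
    (S.fromLeftDerivedZero_eq F).trans (Category.assoc _ _ _).symm
  rw [h6, Category.assoc, ← h5]
  exact leftDerivedIsoOpcycles_naturality F (augmentation P) S P φ (by rw [hφ, hπ]; rfl)

/-- The sum of lifts of `f` and `g` to resolutions is a lift of `f + g`, and any lift computes the
derived map. -/
instance (n : ℕ) : (F.leftDerived n).Additive where
  map_add {X Y f g} := by
    let P := projectiveResolution X
    let Q := projectiveResolution Y
    have nat (k : X ⟶ Y) (φ : P.complex ⟶ Q.complex) (h : φ.f 0 ≫ Q.π.f 0 = P.π.f 0 ≫ k) :=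
      P.isoLeftDerivedObj_hom_naturality k Q φ h F n
    rw [← cancel_mono (Q.isoLeftDerivedObj F n).hom, Preadditive.add_comp,
      nat f (ProjectiveResolution.lift f P Q) (ProjectiveResolution.lift_commutes_zero ..),
      nat g (ProjectiveResolution.lift g P Q) (ProjectiveResolution.lift_commutes_zero ..),
      nat (f + g) (ProjectiveResolution.lift f P Q + ProjectiveResolution.lift g P Q) (by
        rw [HomologicalComplex.add_f_apply, Preadditive.add_comp,
          ProjectiveResolution.lift_commutes_zero, ProjectiveResolution.lift_commutes_zero]
        exact (Preadditive.comp_add ..).symm),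
      Functor.map_add, Preadditive.comp_add]

lemma epi_leftDerived_map_π {X : C} (P : ProjectiveResolution X) :
    Epi ((F.leftDerived 0).map (augmentation P)) := by
  have h := leftDerived_map_π_comp F P
  rw [← Iso.eq_comp_inv] at h
  rw [h]
  infer_instance

lemma exists_leftDerived_map_π_desc {X : C} (P : ProjectiveResolution X) {T : D}
    (k : (F.leftDerived 0).obj (P.complex.X 0) ⟶ T)
    (hk : (F.leftDerived 0).map (P.complex.d 1 0) ≫ k = 0) :
    ∃ l, (F.leftDerived 0).map (augmentation P) ≫ l = k := by
  have h := leftDerived_map_π_comp F P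
  have hn := F.fromLeftDerivedZero.naturality (P.complex.d 1 0)
  let k' : F.obj (P.complex.X 0) ⟶ T := inv (F.fromLeftDerivedZero.app (P.complex.X 0)) ≫ k
  have hk' : F.map (P.complex.d 1 0) ≫ k' = 0 := by
    rw [← cancel_epi (F.fromLeftDerivedZero.app (P.complex.X 1)), ← reassoc_of% hn,
      IsIso.hom_inv_id_assoc, hk, comp_zero]
  refine ⟨(leftDerivedIsoOpcycles F P).hom ≫
    HomologicalComplex.descOpcycles _ k' 1 (by simp) hk', ?_⟩
  have e : toOpcycles F P ≫ HomologicalComplex.descOpcycles _ k' 1 (by simp) hk' = k' :=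
    HomologicalComplex.p_descOpcycles ..
  rw [reassoc_of% h, e, IsIso.hom_inv_id_assoc]

variable {F}

/-- The augmentation of a projective resolution factors through `p`, and its image under `L₀F` is
already epi. -/
lemma epi_leftDerived_map {P X : C} [Projective P] (p : P ⟶ X) [Epi p] :
    Epi ((F.leftDerived 0).map p) := by
  let R := projectiveResolution X
  have := epi_leftDerived_map_π F R
  have h : Projective.factorThru (augmentation R) p ≫ p = augmentation R :=
    Projective.factorThru_comp _ _
  rw [← h, Functor.map_comp] at this
  exact epi_of_epi ((F.leftDerived 0).map (Projective.factorThru (augmentation R) p)) _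

/-- Frees the cokernel description of `L₀F` from the chosen resolution: only the middle term has to
be projective, and it is compared with `P₀` by maps in both directions. -/
lemma exists_leftDerived_map_desc {S : ShortComplex C} (hS : S.Exact) [Epi S.g]
    [Projective S.X₂] {T : D} (k : (F.leftDerived 0).obj S.X₂ ⟶ T)
    (hk : (F.leftDerived 0).map S.f ≫ k = 0) :
    ∃ l, (F.leftDerived 0).map S.g ≫ l = k := by
  let R := projectiveResolution S.X₃
  let π := augmentation R
  let a : R.complex.X 0 ⟶ S.X₂ := Projective.factorThru π S.g
  have ha : a ≫ S.g = π := Projective.factorThru_comp _ _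
  let b : S.X₂ ⟶ R.complex.X 0 := Projective.factorThru S.g π
  have hb : b ≫ π = S.g := Projective.factorThru_comp _ _
  have hda : (R.complex.d 1 0 ≫ a) ≫ S.g = 0 := by
    rw [Category.assoc, ha]; exact d_comp_augmentation R
  have hba : (𝟙 _ - b ≫ a) ≫ S.g = 0 := by
    rw [Preadditive.sub_comp, Category.assoc, ha, hb, Category.id_comp, sub_self]
  obtain ⟨l, hl⟩ := exists_leftDerived_map_π_desc F R ((F.leftDerived 0).map a ≫ k) (by
    rw [← Functor.map_comp_assoc, ← hS.liftFromProjective_comp _ hda, Functor.map_comp_assoc, hk,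
      comp_zero])
  refine ⟨l, ?_⟩
  rw [← hb, Functor.map_comp_assoc]
  rw [hl]
  -- The round trip `b ≫ a` covers the identity of `S.X₃`, so it differs from the identity by a map
  -- through `S.f`, which `k` kills.
  have h : b ≫ a = 𝟙 _ - hS.liftFromProjective _ hba ≫ S.f := by
    rw [hS.liftFromProjective_comp]; abel
  rw [← Functor.map_comp_assoc, h, Functor.map_sub, Preadditive.sub_comp, Functor.map_comp_assoc,
    hk, comp_zero, sub_zero, CategoryTheory.Functor.map_id, Category.id_comp]

/-- No horseshoe lemma is needed: a projective cover `p` of the middle term also covers the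
quotient, and the relations of the latter cover, pushed along `p`, factor through `S.f`. -/
instance [EnoughProjectives C] : PreservesFiniteColimits (F.leftDerived 0) := by
  rw [((F.leftDerived 0).preservesFiniteColimits_tfae.out 3 0 :)]
  intro S hS
  have := hS.mono_f
  have := hS.epi_g
  let p := Projective.π S.X₂
  let ι := kernel.ι (p ≫ S.g)
  let q := Projective.π (kernel (p ≫ S.g))
  have hι : (ι ≫ p) ≫ S.g = 0 := by rw [Category.assoc]; exact kernel.condition _
  let m := hS.exact.lift (ι ≫ p) hι
  have hm : m ≫ S.f = ι ≫ p := hS.exact.lift_f _ _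
  let T := ShortComplex.mk (q ≫ ι) (p ≫ S.g) (by rw [Category.assoc, kernel.condition, comp_zero])
  have hT : T.Exact := exact_comp_kernel_ι (p ≫ S.g) q
  have : Epi T.g := inferInstanceAs (Epi (p ≫ S.g))
  have : Projective T.X₂ := inferInstanceAs (Projective (Projective.over S.X₂))
  have e1 : Epi ((F.leftDerived 0).map p) := epi_leftDerived_map p
  have e2 : Epi ((F.leftDerived 0).map (p ≫ S.g)) := epi_leftDerived_map T.g
  have e3 : Epi ((F.leftDerived 0).map S.g) := by
    rw [Functor.map_comp] at e2; exact epi_of_epi ((F.leftDerived 0).map p) _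
  have : Epi (S.map (F.leftDerived 0)).g := e3
  refine ⟨?_, e3⟩
  apply ShortComplex.exact_of_g_is_cokernel
  have key {Z : D} (k : (F.leftDerived 0).obj S.X₂ ⟶ Z) (hk : (F.leftDerived 0).map S.f ≫ k = 0) :
      ∃ l, (F.leftDerived 0).map S.g ≫ l = k := by
    obtain ⟨l, hl⟩ := exists_leftDerived_map_desc (F := F) hT ((F.leftDerived 0).map p ≫ k) (by
      rw [← Functor.map_comp_assoc]
      change (F.leftDerived 0).map ((q ≫ ι) ≫ p) ≫ k = 0
      rw [Category.assoc, ← hm, ← Category.assoc, Functor.map_comp_assoc, hk, comp_zero])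
    refine ⟨l, ?_⟩
    rw [← cancel_epi ((F.leftDerived 0).map p), ← hl, ← Functor.map_comp_assoc]
  exact CokernelCofork.IsColimit.ofπ' _ _ (fun k hk => ⟨(key k hk).choose, (key k hk).choose_spec⟩)

lemma isIso_leftDerived_zero {G : C ⥤ D} [G.Additive] (α : F ⟶ G)
    (h : ∀ (P : C) [Projective P], IsIso (α.app P)) : IsIso (NatTrans.leftDerived α 0) := by
  have (X : C) : IsIso ((NatTrans.leftDerived α 0).app X) := by
    rw [(projectiveResolution X).leftDerived_app_eq α 0]
    have (n : ℕ) : IsIso (((NatTrans.mapHomologicalComplex α (ComplexShape.down ℕ)).app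
        (projectiveResolution X).complex).f n) := by
      have := (projectiveResolution X).projective n
      exact h _
    have : IsIso ((NatTrans.mapHomologicalComplex α (ComplexShape.down ℕ)).app
        (projectiveResolution X).complex) := HomologicalComplex.Hom.isIso_of_components _
    infer_instance
  exact NatIso.isIso_of_isIso_app _

end

lemma exists_desc_of_preservesFiniteColimits (F : C ⥤ D) [PreservesFiniteColimits F]
    [F.PreservesZeroMorphisms] {S : ShortComplex C} (hS : S.Exact) [Epi S.g]
    {T : D} (k : F.obj S.X₂ ⟶ T) (hk : F.map S.f ≫ k = 0) : ∃ l, F.map S.g ≫ l = k :=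
  have h := CokernelCofork.mapIsColimit _ hS.gIsCokernel F
  ⟨h.desc (CokernelCofork.ofπ k hk), h.fac _ WalkingParallelPair.one⟩

/-- A presentation `Q ⟶ P ⟶ X` by objects at which `α` is invertible exhibits `F X` and `G X` as
cokernels of isomorphic maps. -/
lemma isIso_of_preservesFiniteColimits {F G : C ⥤ D} [PreservesFiniteColimits F]
    [PreservesFiniteColimits G] [F.PreservesZeroMorphisms] [G.PreservesZeroMorphisms]
    (α : F ⟶ G) (h : ∀ X : C, ∃ (P : C) (p : P ⟶ X), Epi p ∧ IsIso (α.app P)) : IsIso α := by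
  have (X : C) : IsIso (α.app X) := by
    obtain ⟨P, p, _, _⟩ := h X
    obtain ⟨Q, q, _, _⟩ := h (kernel p)
    let S := ShortComplex.mk (q ≫ kernel.ι p) p (by simp)
    have hS : S.Exact := exact_comp_kernel_ι p q
    have : Epi S.g := inferInstanceAs (Epi p)
    obtain ⟨l, hl⟩ := exists_desc_of_preservesFiniteColimits G hS (inv (α.app P) ≫ F.map p) (by
      rw [← cancel_epi (α.app Q)]
      change α.app Q ≫ G.map (q ≫ kernel.ι p) ≫ _ = _
      rw [← α.naturality_assoc, IsIso.hom_inv_id_assoc, ← Functor.map_comp, Category.assoc,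
        kernel.condition, comp_zero, comp_zero, Functor.map_zero])
    replace hl : G.map p ≫ l = inv (α.app P) ≫ F.map p := hl
    refine ⟨l, ?_, ?_⟩
    · rw [← cancel_epi (F.map p), α.naturality_assoc, hl, IsIso.hom_inv_id_assoc, Category.comp_id]
    · rw [← cancel_epi (G.map p), reassoc_of% hl, α.naturality, IsIso.inv_hom_id_assoc,
        Category.comp_id]
  exact NatIso.isIso_of_isIso_app _

end RightExact
-- Constructing a left adjoint from its values on projectives.
section ExistsAdjunction

variable {C : Type*} [Category* C] [Abelian C] {D : Type*} [Category* D] [Abelian D]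
  [EnoughProjectives D]

lemma exists_exact_projective (X : D) :
    ∃ S : ShortComplex D, S.X₃ = X ∧ S.Exact ∧ Epi S.g ∧ Projective S.X₁ ∧ Projective S.X₂ := by
  have : Epi (Projective.π X) := inferInstance
  exact ⟨_, rfl, exact_comp_kernel_ι (Projective.π X) (Projective.π _), this,
    Projective.projective_over _, Projective.projective_over _⟩

/-- The objects at which a left adjoint is defined are closed under the colimits available in `C`,
and every object of `D` is the cokernel of a map between projectives. -/
lemma isRightAdjoint_of_projective (U : C ⥤ D)
    (h : ∀ (P : D) [Projective P], U.leftAdjointObjIsDefined P) : U.IsRightAdjoint := by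
  apply Functor.isRightAdjoint_of_leftAdjointObjIsDefined_eq_top
  ext X
  simp only [Pi.top_apply, Prop.top_eq_true, iff_true]
  obtain ⟨S, rfl, hS, _, _, _⟩ := exists_exact_projective X
  refine Functor.leftAdjointObjIsDefined_of_isColimit hS.gIsCokernel (fun j => ?_)
  cases j
  · exact h S.X₁
  · exact h S.X₂

/-- A right exact functor `U` has a fully faithful left adjoint `L₀ H` as soon as there are
universal isomorphisms `P ⟶ U (H P)` for `P` projective. -/
theorem exists_adjunction_leftDerived (U : C ⥤ D) [U.Additive] [PreservesFiniteColimits U]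
    (H : D ⥤ C) [H.Additive] (η : 𝟭 D ⟶ H ⋙ U) (h₁ : ∀ (P : D) [Projective P], IsIso (η.app P))
    (h₂ : ∀ (P : D) [Projective P] (Y : C),
      Function.Bijective (fun β : H.obj P ⟶ Y => (η.app P ≫ U.map β : P ⟶ U.obj Y))) :
    ∃ adj : H.leftDerived 0 ⊣ U, IsIso adj.unit := by
  have : U.IsRightAdjoint := isRightAdjoint_of_projective U (fun P _ => by
    have r : (U ⋙ coyoneda.obj (op P)).CorepresentableBy (H.obj P) :=
      { homEquiv {Y} := Equiv.ofBijective _ (h₂ P Y)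
        homEquiv_comp {Y Y'} g f := by
          change η.app P ≫ U.map (f ≫ g) = (η.app P ≫ U.map f) ≫ U.map g
          simp }
    exact r.isCorepresentable)
  let L := U.leftAdjoint
  let adj : L ⊣ U := Adjunction.ofIsRightAdjoint U
  have : L.Additive := adj.left_adjoint_additive
  have : PreservesFiniteColimits L :=
    have := adj.leftAdjoint_preservesColimits
    inferInstance
  -- The transpose of `η`; it compares the abstract left adjoint `L` with `H`.
  let α : L ⟶ H :=
    { app X := (adj.homEquiv _ _).symm (η.app X)
      naturality X Y f := by
        rw [← adj.homEquiv_naturality_left_symm, ← adj.homEquiv_naturality_right_symm]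
        exact congrArg _ (η.naturality f) }
  have hα (X : D) : adj.unit.app X ≫ U.map (α.app X) = η.app X := by
    refine (adj.homEquiv_unit _ _ _).symm.trans ?_
    exact Equiv.apply_symm_apply _ _
  -- For projective `P`, both `L P` and `H P` corepresent `Y ↦ Hom(P, U Y)`, with universal elements
  -- matched by `α`.
  have hαP (P : D) [Projective P] : IsIso (α.app P) := by
    obtain ⟨γ, hγ⟩ := (h₂ P (L.obj P)).2 (adj.unit.app P)
    replace hγ : η.app P ≫ U.map γ = adj.unit.app P := hγ
    refine ⟨γ, ?_, ?_⟩
    · apply (adj.homEquiv _ _).injective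
      rw [adj.homEquiv_unit, adj.homEquiv_unit, U.map_comp, reassoc_of% hα, hγ]
      simp
    · apply (h₂ P _).1
      change η.app P ≫ U.map (γ ≫ α.app P) = η.app P ≫ U.map (𝟙 _)
      rw [U.map_comp, reassoc_of% hγ, hα]
      simp
  have : IsIso (NatTrans.leftDerived α 0) := isIso_leftDerived_zero α hαP
  -- As a left adjoint, `L` is right exact and so equals its own zeroth derived functor, which
  -- depends only on the values at projectives.
  let e : L ≅ H.leftDerived 0 :=
    L.leftDerivedZeroIsoSelf.symm ≪≫ asIso (NatTrans.leftDerived α 0)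
  -- Both `𝟭 D` and `L ⋙ U` are right exact, so projective covers suffice; there the unit followed
  -- by the isomorphism `U α` is `η`.
  have hu : IsIso adj.unit := by
    refine isIso_of_preservesFiniteColimits adj.unit (fun X => ⟨_, Projective.π X, inferInstance, ?_⟩)
    have h := hα (Projective.over X)
    have := hαP (Projective.over X)
    have := h₁ (Projective.over X)
    exact IsIso.of_isIso_fac_right h
  refine ⟨adj.ofNatIsoLeft e, ?_⟩
  have (X : D) : IsIso ((adj.ofNatIsoLeft e).unit.app X) := by
    have : (adj.ofNatIsoLeft e).unit.app X = adj.unit.app X ≫ U.map (e.hom.app X) := by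
      simp [Adjunction.ofNatIsoLeft]
    rw [this]
    infer_instance
  exact NatIso.isIso_of_isIso_app _

end ExistsAdjunction

/-! ### Presentations by representables and right exact functors on them. -/

section FinPres

variable {C : Type u} [Category.{v} C] [Abelian C]

instance : (yon C).Full := inferInstanceAs ((finPres C).lift preadditiveCoyoneda _).Full
instance : (yon C).Faithful := inferInstanceAs ((finPres C).lift preadditiveCoyoneda _).Faithful

/-- The sequence `(Y, -) ⟶ (X, -) ⟶ F` given by a presentation. -/
noncomputable def EltPres.shortComplex {F : FP C} {X Y : C} {f : X ⟶ Y} {x : F.obj.obj X}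
    (h : EltPres F.obj f x) : ShortComplex (FP C) :=
  ShortComplex.mk ((yon C).map f.op) (ObjectProperty.homMk (ofElt F.obj x) : (yon C).obj (op X) ⟶ F)
    (by
      ext A g
      exact h.zero (g : Y ⟶ A))

lemma EltPres.epi_g {F : FP C} {X Y : C} {f : X ⟶ Y} {x : F.obj.obj X}
    (h : EltPres F.obj f x) : Epi h.shortComplex.g := by
  have (A : C) : Epi ((ofElt F.obj x).app A) :=
    (AddCommGrpCat.epi_iff_surjective _).2 (isRightExactSeq_of_eltPres h A).2
  have h2 : Epi (ofElt F.obj x) := NatTrans.epi_of_epi_app _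
  have h3 : Epi ((finPres C).ι.map h.shortComplex.g) := h2
  exact (finPres C).ι.epi_of_epi_map h3

/-- By Yoneda a map `(X, -) ⟶ G` is an element of `G X`; it vanishes on `(Y, -)` when `G f` kills
this element, which is the condition for it to define a map out of `F`. -/
lemma EltPres.exact {F : FP C} {X Y : C} {f : X ⟶ Y} {x : F.obj.obj X}
    (h : EltPres F.obj f x) : h.shortComplex.Exact := by
  have := h.epi_g
  apply ShortComplex.exact_of_g_is_cokernel
  have key {G : FP C} (k : (yon C).obj (op X) ⟶ G) (hk : (yon C).map f.op ≫ k = 0) :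
      ∃ l : F ⟶ G, h.shortComplex.g ≫ l = k := by
    have h0 : G.obj.map f (elt k.hom) = 0 := by
      have e : ((yon C).map f.op ≫ k).hom.app Y (𝟙 Y : Y ⟶ Y) = 0 := by rw [hk]; rfl
      refine (app_eq k.hom f).symm.trans (Eq.trans ?_ e)
      exact congrArg (k.hom.app Y) (Category.comp_id f).symm
    obtain ⟨l, hl⟩ := h.exists_hom G.obj (elt k.hom) h0
    refine ⟨ObjectProperty.homMk l, ?_⟩
    ext : 1
    apply hom_ext_elt
    refine Eq.trans ?_ hl
    exact congrArg (l.app X) (elt_ofElt F.obj x)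
  exact CokernelCofork.IsColimit.ofπ' _ _
    (fun k hk => ⟨(key k hk).choose, (key k hk).choose_spec⟩)

lemma exists_eltPres (F : FP C) : ∃ (X Y : C) (f : X ⟶ Y) (x : F.obj.obj X), EltPres F.obj f x :=
  ((finPres_iff F.obj).1 F.property).2

/-- Since `(A, -)` and `P` are projective and `U` is right exact, both `Hom((A, -), F)` and `Hom(P,
U F)` are right exact in `F`. A presentation of `F` therefore reduces the claim to representables.
-/
lemma bijective_comp_map_of_projective {D : Type*} [Category* D] [Abelian D] (U : FP C ⥤ D)
    [U.Additive] [PreservesFiniteColimits U] {P : D} [Projective P] {A : Cᵒᵖ}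
    (η : P ⟶ U.obj ((yon C).obj A))
    (h : ∀ B : Cᵒᵖ, Function.Bijective (fun g : A ⟶ B => η ≫ U.map ((yon C).map g))) (F : FP C) :
    Function.Bijective (fun β : (yon C).obj A ⟶ F => η ≫ U.map β) := by
  obtain ⟨X, Y, f, x, hx⟩ := exists_eltPres F
  have := hx.epi_g
  let π : (yon C).obj (op X) ⟶ F := hx.shortComplex.g
  have : Epi π := hx.epi_g
  obtain ⟨hU, _⟩ := (U.preservesFiniteColimits_tfae.out 3 1 :).1 inferInstance _ ⟨hx.exact, hx.epi_g⟩
  have : Epi (U.map π) := inferInstance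
  constructor
  · intro β β' hβ
    rw [← sub_eq_zero]
    have h0 : η ≫ U.map (β - β') = 0 := by
      rw [U.map_sub, Preadditive.comp_sub, sub_eq_zero]; exact hβ
    generalize β - β' = δ at h0
    obtain ⟨g, hg⟩ := (yon C).map_surjective (Projective.factorThru δ π)
    have hδ : δ = (yon C).map g ≫ π := by rw [hg, Projective.factorThru_comp]
    have h1 : (η ≫ U.map ((yon C).map g)) ≫ U.map π = 0 := by
      rw [Category.assoc, ← U.map_comp, ← hδ, h0]
    -- The lift to `U (Y, -)` comes from a morphism `k`, and injectivity at `X` forces `g` to factor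
    -- through `f`; hence `δ` vanishes.
    obtain ⟨k, hk⟩ := (h (op Y)).2 (hU.liftFromProjective _ h1)
    have hk' : g = k ≫ f.op := by
      apply (h _).1
      change η ≫ U.map ((yon C).map g) = η ≫ U.map ((yon C).map (k ≫ f.op))
      rw [Functor.map_comp, U.map_comp, ← Category.assoc]
      replace hk : η ≫ U.map ((yon C).map k) = hU.liftFromProjective _ h1 := hk
      rw [hk]
      exact (hU.liftFromProjective_comp _ h1).symm
    rw [hδ, hk', Functor.map_comp, Category.assoc]
    exact (congrArg _ hx.shortComplex.zero).trans comp_zero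
  · intro ψ
    obtain ⟨g, hg⟩ := (h (op X)).2 (Projective.factorThru ψ (U.map π))
    refine ⟨(yon C).map g ≫ π, ?_⟩
    change η ≫ U.map ((yon C).map g ≫ π) = ψ
    replace hg : η ≫ U.map ((yon C).map g) = Projective.factorThru ψ (U.map π) := hg
    rw [U.map_comp, reassoc_of% hg, Projective.factorThru_comp]

lemma isZero_obj_iff_epi {D : Type*} [Category* D] [Abelian D] (U : FP C ⥤ D)
    [U.Additive] [PreservesFiniteColimits U] {F : FP C} {X Y : C} {f : X ⟶ Y} {x : F.obj.obj X}
    (h : EltPres F.obj f x) : IsZero (U.obj F) ↔ Epi (U.map ((yon C).map f.op)) := by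
  obtain ⟨hU, _⟩ := (U.preservesFiniteColimits_tfae.out 3 1 :).1 inferInstance _ ⟨h.exact, h.epi_g⟩
  have h1 : Epi (h.shortComplex.map U).g := by assumption
  refine Iff.trans ?_ hU.epi_f_iff.symm
  constructor
  · intro hz
    exact hz.eq_of_tgt _ _
  · intro hz
    refine (IsZero.iff_id_eq_zero (h.shortComplex.map U).X₃).2 ?_
    refine (cancel_epi (h.shortComplex.map U).g).1 ?_
    rw [hz, zero_comp, zero_comp]

end FinPres
-- Injective additive functors are right exact.
section InjectiveAdditiveFunctors

variable {D : Type u} [Category.{v} D] [Preadditive D]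

lemma exact_of_exact_app (S : ShortComplex (D ⥤+ AddCommGrpCat.{v}))
    (h : ∀ A, Function.Exact (S.f.hom.app A) (S.g.hom.app A)) : S.Exact := by
  rw [ShortComplex.exact_iff_kernel_ι_comp_cokernel_π_zero]
  ext A x
  have h1 : S.g.hom.app A ((kernel.ι S.g).hom.app A x) = 0 := by
    have := congrArg (fun φ => φ.hom.app A x) (kernel.condition S.g)
    exact this
  obtain ⟨y, hy⟩ := (h A _).1 h1
  have h2 : (cokernel.π S.f).hom.app A (S.f.hom.app A y) = 0 := by
    have := congrArg (fun φ => φ.hom.app A y) (cokernel.condition S.f)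
    exact this
  change (cokernel.π S.f).hom.app A ((kernel.ι S.g).hom.app A x) = 0
  rw [← hy, h2]

lemma mono_of_injective_app {F G : D ⥤+ AddCommGrpCat.{v}} (f : F ⟶ G)
    (h : ∀ A, Function.Injective (f.hom.app A)) : Mono f := by
  have (A : D) : Mono (f.hom.app A) := (AddCommGrpCat.mono_iff_injective _).2 (h A)
  have h2 : Mono f.hom := NatTrans.mono_of_mono_app _
  have h3 : Mono ((additiveFunctor D AddCommGrpCat.{v}).ι.map f) := h2
  exact (additiveFunctor D AddCommGrpCat.{v}).ι.mono_of_mono_map h3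

lemma isIso_of_bijective_app {F G : D ⥤+ AddCommGrpCat.{v}} (f : F ⟶ G)
    (h : ∀ A, Function.Bijective (f.hom.app A)) : IsIso f := by
  have (A : D) : IsIso (f.hom.app A) := (ConcreteCategory.isIso_iff_bijective _).2 (h A)
  have h2 : IsIso f.hom := NatIso.isIso_of_isIso_app _
  have h3 : IsIso ((additiveFunctor D AddCommGrpCat.{v}).ι.map f) := h2
  exact isIso_of_reflects_iso f (additiveFunctor D AddCommGrpCat.{v}).ι

/-- The additive functor `(X, -)`. -/
def corep (X : D) : D ⥤+ AddCommGrpCat.{v} := AdditiveFunctor.of (preadditiveCoyoneda.obj (op X))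

/-- The transformation `(Y, -) ⟶ (X, -)` induced by `X ⟶ Y`. -/
def corepMap {X Y : D} (f : X ⟶ Y) : corep Y ⟶ corep X :=
  ObjectProperty.homMk (preadditiveCoyoneda.map f.op)

/-- The transformation `(X, -) ⟶ F` given by an element of `F X`. -/
def ofElement (F : D ⥤+ AddCommGrpCat.{v}) {X : D} (x : F.obj.obj X) : corep X ⟶ F :=
  ObjectProperty.homMk
    { app A := AddCommGrpCat.ofHom (AddMonoidHom.mk' (fun g : X ⟶ A => F.obj.map g x)
        (fun g h => map_add_apply' F.obj (g : X ⟶ A) (h : X ⟶ A) x))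
      naturality A B k := by
        ext g
        exact map_comp_apply' F.obj (g : X ⟶ A) k x }

lemma app_eq_map {F : D ⥤+ AddCommGrpCat.{v}} {X : D} (π : corep X ⟶ F) {A : D} (g : X ⟶ A) :
    π.hom.app A g = F.obj.map g (π.hom.app X (𝟙 X : X ⟶ X)) := by
  have := ConcreteCategory.congr_hom (π.hom.naturality g) (𝟙 X : X ⟶ X)
  refine Eq.trans ?_ this
  exact congrArg (π.hom.app A) (Category.id_comp g).symm

variable (I : D ⥤+ AddCommGrpCat.{v}) [Injective I]

/-- An epi `p` makes `(L, -) ⟶ (A, -)` mono, so the map `(L, -) ⟶ I` given by `y` extends to `(A,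
-)`; the extension is a preimage of `y`. -/
lemma surjective_map_of_injective {A L : D} (p : A ⟶ L) [Epi p] :
    Function.Surjective (I.obj.map p) := by
  intro y
  have : Mono (corepMap p) := mono_of_injective_app _ (fun B g h e =>
    (cancel_epi p).1 (e : p ≫ (g : L ⟶ B) = p ≫ (h : L ⟶ B)))
  let φ := Injective.factorThru (ofElement I y) (corepMap p)
  have hφ : corepMap p ≫ φ = ofElement I y := Injective.comp_factorThru _ _
  refine ⟨φ.hom.app A (𝟙 A : A ⟶ A), ?_⟩
  rw [← app_eq_map φ p]
  have e := congrArg (fun ψ => ψ.hom.app L (𝟙 L : L ⟶ L)) hφ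
  have e1 : φ.hom.app L (p ≫ 𝟙 L : A ⟶ L) = I.obj.map (𝟙 L) y := e
  have e2 : φ.hom.app L (p : A ⟶ L) = φ.hom.app L (p ≫ 𝟙 L : A ⟶ L) :=
    congrArg (φ.hom.app L) (Category.comp_id p).symm
  rw [e2, e1, I.obj.map_id]
  rfl

/-- If `p` is a weak cokernel of `f`, then `(L, -) ⟶ (A, -) ⟶ (A', -)` is exact. An element of `I A`
killed by `p` is a map `(A, -) ⟶ I` vanishing on `(L, -)`, so injectivity extends it along `(A, -) ⟶
(A', -)`. -/
lemma exact_map_of_injective {A' A L : D} (f : A' ⟶ A) (p : A ⟶ L) (w : f ≫ p = 0)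
    (h : ∀ {B : D} (g : A ⟶ B), f ≫ g = 0 → ∃ k, p ≫ k = g) :
    Function.Exact (I.obj.map f) (I.obj.map p) := by
  have w' {B : D} (g : L ⟶ B) : f ≫ p ≫ g = 0 := by rw [← Category.assoc, w, zero_comp]
  intro y
  constructor
  · intro hy
    let S : ShortComplex (D ⥤+ AddCommGrpCat.{v}) := ShortComplex.mk (corepMap p) (corepMap f) (by
      ext B g
      exact w' (g : L ⟶ B))
    have hS : S.Exact := exact_of_exact_app S (fun B g => by
      constructor
      · intro hg
        obtain ⟨k, hk⟩ := h (g : A ⟶ B) hg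
        exact ⟨k, hk⟩
      · rintro ⟨k, rfl⟩
        exact w' (k : L ⟶ B))
    have h0 : S.f ≫ ofElement I y = 0 := by
      ext B g
      exact (map_comp_apply' I.obj p (g : L ⟶ B) y).trans
        ((congrArg _ hy).trans (map_zero (I.obj.map (g : L ⟶ B)).hom))
    let φ : corep A' ⟶ I := hS.descToInjective _ h0
    have hφ : corepMap f ≫ φ = ofElement I y := hS.comp_descToInjective _ h0
    refine ⟨φ.hom.app A' (𝟙 A' : A' ⟶ A'), ?_⟩
    rw [← app_eq_map φ f]
    have e := congrArg (fun ψ => ψ.hom.app A (𝟙 A : A ⟶ A)) hφ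
    have e1 : φ.hom.app A (f ≫ 𝟙 A : A' ⟶ A) = I.obj.map (𝟙 A) y := e
    have e2 : φ.hom.app A (f : A' ⟶ A) = φ.hom.app A (f ≫ 𝟙 A : A' ⟶ A) :=
      congrArg (φ.hom.app A) (Category.comp_id f).symm
    rw [e2, e1, I.obj.map_id]
    rfl
  · rintro ⟨z, rfl⟩
    rw [← map_comp_apply', w, I.obj.map_zero]
    rfl

end InjectiveAdditiveFunctors

/-! ### Calculus in the balanced tensor product. -/

namespace BalancedTensor

variable {R : Type u} [Ring R] {X : Type u} [AddCommGroup X] [Module Rᵐᵒᵖ X] {L : Type u}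
  [AddCommGroup L] [Module R L]

lemma smul_tmul (r : R) (x : X) (l : L) :
    (tmul (MulOpposite.op r • x) l : BalancedTensor R X L) = tmul x (r • l) := by
  rw [← sub_eq_zero]
  exact (QuotientAddGroup.eq_zero_iff _).2 (AddSubgroup.subset_closure ⟨x, r, l, rfl⟩)

/-- The biadditive map `(x, l) ↦ x ⊗ l`. -/
def tmulHom : X →+ L →+ BalancedTensor R X L :=
  AddMonoidHom.mk' (fun x => AddMonoidHom.mk' (tmul x) (tmul_add x))
    (fun x y => AddMonoidHom.ext (add_tmul x y))

lemma tmul_sum {ι : Type*} (s : Finset ι) (x : X) (l : ι → L) :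
    (tmul x (∑ i ∈ s, l i) : BalancedTensor R X L) = ∑ i ∈ s, tmul x (l i) :=
  map_sum (tmulHom x) l s

lemma sum_tmul {ι : Type*} (s : Finset ι) (x : ι → X) (l : L) :
    (tmul (∑ i ∈ s, x i) l : BalancedTensor R X L) = ∑ i ∈ s, tmul (x i) l :=
  map_sum (tmulHom.flip l) x s

/-- The homomorphism induced by a balanced biadditive map. -/
def lift {A : Type*} [AddCommGroup A] (φ : X →+ L →+ A)
    (h : ∀ (r : R) (x : X) (l : L), φ (MulOpposite.op r • x) l = φ x (r • l)) :
    BalancedTensor R X L →+ A :=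
  QuotientAddGroup.lift _
    (TensorProduct.liftAddHom φ (fun n x l => by simp)) (by
      rw [balancedRelations, AddSubgroup.closure_le]
      rintro _ ⟨x, r, l, rfl⟩
      simp [h])

/-- Scalars move across the tensor sign, so a generating family of `L` can serve as the fixed
right-hand factors. -/
lemma exists_eq_sum_tmul {n : ℕ} (l : Fin n → L) (hl : ∀ k, ∃ r : Fin n → R, ∑ i, r i • l i = k)
    (z : BalancedTensor R X L) : ∃ x : Fin n → X, z = ∑ i, tmul (x i) (l i) := by
  obtain ⟨z, rfl⟩ := QuotientAddGroup.mk_surjective z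
  induction z using TensorProduct.induction_on with
  | zero => exact ⟨0, (Finset.sum_eq_zero (fun i _ => map_zero (tmulHom.flip (l i)))).symm⟩
  | tmul x k =>
    obtain ⟨r, rfl⟩ := hl k
    refine ⟨fun i => MulOpposite.op (r i) • x, ?_⟩
    refine (tmul_sum _ x _).trans ?_
    exact Finset.sum_congr rfl (fun i _ => (smul_tmul _ _ _).symm)
  | add a b ha hb =>
    obtain ⟨x, hx⟩ := ha
    obtain ⟨y, hy⟩ := hb
    refine ⟨x + y, ?_⟩
    rw [QuotientAddGroup.mk_add, hx, hy, ← Finset.sum_add_distrib]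
    exact Finset.sum_congr rfl (fun i _ => (add_tmul _ _ _).symm)

end BalancedTensor

/-! ### The adjunction between `t` and `ev_R`, and its counit at injectives. -/

section TensorAdjunction

variable (R : Type u) [Ring R]

variable {R} in
/-- The homomorphism `R ⟶ L`, `r ↦ r • l`. -/
def spanMap {L : FPMod R} (l : L.obj) : regular R ⟶ L :=
  ObjectProperty.homMk (ModuleCat.ofHom (LinearMap.toSpanSingleton R L.obj l))

section
variable {R}

lemma spanMap_comp {L L' : FPMod R} (l : L.obj) (g : L ⟶ L') : spanMap l ≫ g = spanMap (g.hom.hom l) :=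
  ObjectProperty.hom_ext _ (ModuleCat.hom_ext (LinearMap.ext fun (r : R) =>
    map_smul g.hom.hom r l))

lemma rightMul_comp_spanMap {L : FPMod R} (r : R) (l : L.obj) :
    rightMul R r ≫ spanMap l = spanMap (r • l) := spanMap_comp (L := regular R) (r : R) (spanMap l)

lemma spanMap_add {L : FPMod R} (l l' : L.obj) : spanMap (l + l') = spanMap l + spanMap l' :=
  ObjectProperty.hom_ext _ (ModuleCat.hom_ext (LinearMap.ext fun (r : R) => smul_add r l l'))

lemma spanMap_one : spanMap (L := regular R) (1 : R) = 𝟙 (regular R) :=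
  ObjectProperty.hom_ext _ (ModuleCat.hom_ext (LinearMap.ext fun (r : R) => mul_one r))

end

/-- The transformation `G(R) ⊗_R - ⟶ G`. -/
def tensorCounit (G : AddFun R) : (tensorEmbedding R).obj ((evR R).obj G) ⟶ G :=
  ObjectProperty.homMk
    { app L := AddCommGrpCat.ofHom (BalancedTensor.lift
        (AddMonoidHom.mk' (fun x : G.obj.obj (regular R) =>
          AddMonoidHom.mk' (fun l : L.obj => (G.obj.map (spanMap l) x : G.obj.obj L))
            (fun l l' => by rw [spanMap_add, map_add_apply']))
          (fun x y => AddMonoidHom.ext (fun l => map_add (G.obj.map (spanMap l)).hom x y)))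
        (fun r x l => by
          refine (map_comp_apply' G.obj (rightMul R r) (spanMap l) x).symm.trans ?_
          rw [rightMul_comp_spanMap]
          rfl))
      naturality L L' g := AddCommGrpCat.hom_ext (BalancedTensor.hom_ext (fun x l => by
        refine Eq.trans ?_ (map_comp_apply' G.obj (spanMap l) g x)
        rw [spanMap_comp]
        rfl)) }

/-- The homomorphism `X ⟶ X ⊗_R R`. -/
def tensorUnit (X : ModuleCat.{u} Rᵐᵒᵖ) : X ⟶ (evR R).obj ((tensorEmbedding R).obj X) :=
  ModuleCat.ofHom
    { toFun x := BalancedTensor.tmul (R := R) (L := R) x (1 : R)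
      map_add' x y := BalancedTensor.add_tmul _ _ _
      map_smul' r x := by
        refine (BalancedTensor.smul_tmul r.unop x (1 : R)).trans ?_
        change BalancedTensor.tmul (R := R) (L := R) x (r.unop * 1) =
          BalancedTensor.tmul (R := R) (L := R) x (1 * r.unop)
        rw [mul_one, one_mul] }

/-- The tensor embedding is left adjoint to evaluation at `R`. -/
def tensorAdjunction : tensorEmbedding R ⊣ evR R :=
  Adjunction.mkOfUnitCounit
    { unit :=
        { app := tensorUnit R
          naturality _ _ _ := rfl }
      counit :=
        { app := tensorCounit R
          naturality G G' α := by
            ext L : 3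
            exact AddCommGrpCat.hom_ext (BalancedTensor.hom_ext (fun x l =>
              (nat_apply α.hom (spanMap l) x).symm)) }
      left_triangle := by
        ext X L : 5
        exact AddCommGrpCat.hom_ext (BalancedTensor.hom_ext (fun x l =>
          congrArg (BalancedTensor.tmul x) (one_smul R (l : L.obj))))
      right_triangle := by
        ext G x
        change G.obj.map (spanMap (L := regular R) (1 : R)) x = x
        rw [spanMap_one, G.obj.map_id]
        rfl }

/-- The map `x ⊗ r ↦ xr` is a left inverse. This lets monomorphy of `t f` be reflected back to `f`.
-/
instance (X : ModuleCat.{u} Rᵐᵒᵖ) : Mono (tensorUnit R X) := by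
  rw [ModuleCat.mono_iff_injective]
  let ρ : BalancedTensor R X R →+ X := BalancedTensor.lift
    (AddMonoidHom.mk' (fun x => AddMonoidHom.mk' (fun r : R => MulOpposite.op r • x)
      (fun r s => by rw [MulOpposite.op_add, add_smul]))
      (fun x y => AddMonoidHom.ext (fun r => smul_add (MulOpposite.op r) x y)))
    (fun r x s => by
      change MulOpposite.op s • MulOpposite.op r • x = MulOpposite.op (r * s) • x
      rw [MulOpposite.op_mul, mul_smul])
  exact Function.LeftInverse.injective (g := ρ) (fun x => one_smul Rᵐᵒᵖ x)


variable {R} in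
/-- The free left module of rank `n`. -/
def free (n : ℕ) : FPMod R :=
  ⟨ModuleCat.of R (Fin n → R), inferInstanceAs (Module.FinitePresentation R (Fin n → R))⟩

section

variable {R} {n m : ℕ}

/-- The `i`-th projection. -/
def free.proj (i : Fin n) : free (R := R) n ⟶ regular R :=
  ObjectProperty.homMk (ModuleCat.ofHom (LinearMap.proj i))

/-- The `i`-th basis vector. -/
def free.basis (i : Fin n) : (free (R := R) n).obj := (Pi.single i (1 : R) : Fin n → R)

lemma free.eq_sum (r : Fin n → R) : ∑ i, r i • (Pi.single i (1 : R) : Fin n → R) = r := by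
  ext j
  simp [Finset.sum_apply, Pi.single_apply]

lemma free.sum_proj_comp :
    ∑ i : Fin n, free.proj i ≫ spanMap (free.basis i) = 𝟙 (free (R := R) n) := by
  let φ : (free (R := R) n ⟶ free n) →+ ((Fin n → R) →ₗ[R] (Fin n → R)) :=
    AddMonoidHom.mk' (fun k => k.hom.hom) (fun _ _ => rfl)
  have hφ : Function.Injective φ := fun k l h => ObjectProperty.hom_ext _ (ModuleCat.hom_ext h)
  apply hφ
  rw [map_sum]
  refine LinearMap.ext fun r => ?_
  rw [LinearMap.sum_apply]
  exact free.eq_sum r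

/-- Together with `free.map_proj_sum`, this is the identification of `G(Rⁿ)` with `G(R)ⁿ` for
additive `G`. -/
lemma free.sum_map (G : AddFun R) (x : G.obj.obj (free n)) :
    ∑ i : Fin n, G.obj.map (spanMap (free.basis i)) (G.obj.map (free.proj i) x) = x := by
  let φ : (free (R := R) n ⟶ free n) →+ G.obj.obj (free n) :=
    AddMonoidHom.mk' (fun k => G.obj.map k x) (fun k l => map_add_apply' G.obj k l x)
  have h : φ (∑ i : Fin n, free.proj i ≫ spanMap (free.basis i)) = x := by
    rw [free.sum_proj_comp]
    change G.obj.map (𝟙 _) x = x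
    rw [G.obj.map_id]; rfl
  refine Eq.trans ?_ h
  rw [map_sum]
  exact Finset.sum_congr rfl (fun i _ => (map_comp_apply' G.obj _ _ x).symm)

lemma free.map_proj_sum (G : AddFun R) (x : Fin n → G.obj.obj (regular R)) (i : Fin n) :
    G.obj.map (free.proj i) (∑ j, G.obj.map (spanMap (free.basis j)) (x j)) = x i := by
  rw [map_sum, Finset.sum_eq_single i]
  · rw [← map_comp_apply', spanMap_comp]
    have : (free.proj i).hom.hom (free.basis i) = (1 : R) :=
      Pi.single_eq_same (M := fun _ : Fin n => R) i (1 : R)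
    rw [this, spanMap_one, G.obj.map_id]
    rfl
  · intro j _ hj
    rw [← map_comp_apply', spanMap_comp]
    have : (free.proj i).hom.hom (free.basis j) = (0 : R) :=
      Pi.single_eq_of_ne (M := fun _ : Fin n => R) hj.symm (1 : R)
    rw [this]
    have h0 : spanMap (L := regular R) (0 : R) = 0 :=
      ObjectProperty.hom_ext _ (ModuleCat.hom_ext (LinearMap.ext fun (r : R) => mul_zero r))
    rw [h0, G.obj.map_zero]
    rfl
  · simp

end

/-- A family of elements of the module `G(R)` as a family of elements of the group `G(R)`. -/
def toValue {G : AddFun R} {n : ℕ} (x : Fin n → (evR R).obj G) : Fin n → G.obj.obj (regular R) := x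

/-- Both `I(R) ⊗_R -` and `I` are right exact and they agree on finite free modules, hence on any
`L` with a presentation `Rᵐ ⟶ Rⁿ ⟶ L`. The comparison is carried out on elements. -/
theorem isIso_tensorCounit_of_injective (I : AddFun R) [Injective I] : IsIso (tensorCounit R I) := by
  refine isIso_of_bijective_app _ (fun L => ?_)
  have hL : Module.FinitePresentation R L.obj := L.property
  obtain ⟨n, m, p, f, hp, hfp⟩ := Module.FinitePresentation.exists_fin' R L.obj
  let p' : free n ⟶ L := ObjectProperty.homMk (ModuleCat.ofHom p)
  let f' : free m ⟶ free (R := R) n := ObjectProperty.homMk (ModuleCat.ofHom f)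
  let l (i : Fin n) : L.obj := p'.hom.hom (free.basis i)
  have hepi : Epi p' := by
    have : Epi ((fpModules R).ι.map p') := (ModuleCat.epi_iff_surjective _).2 hp
    exact (fpModules R).ι.epi_of_epi_map this
  have hfp' (r : Fin m → R) : p (f r) = 0 := hfp.apply_apply_eq_zero r
  have hpl (r : Fin n → R) : ∑ i, r i • l i = p r := by
    refine Eq.trans ?_ (congrArg p (free.eq_sum r))
    rw [map_sum]
    exact Finset.sum_congr rfl (fun i _ => (map_smul p (r i) (Pi.single i (1 : R) : Fin n → R)).symm)
  have hs := surjective_map_of_injective I p'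
  have he := exact_map_of_injective I f' p'
    (ObjectProperty.hom_ext _ (ModuleCat.hom_ext (LinearMap.ext hfp'))) (fun {B} g hg => by
      -- `p'` is a cokernel of `f'` among finitely presented modules: a map killing the image of
      -- `f`, which is the kernel of `p`, descends to `L`.
      have hker : LinearMap.ker p ≤ LinearMap.ker g.hom.hom := by
        intro r hr
        obtain ⟨q, rfl⟩ := (hfp r).1 hr
        exact congrArg (fun k => k.hom.hom q) hg
      let g' : (Fin n → R) →ₗ[R] B.obj := g.hom.hom
      replace hker : LinearMap.ker p ≤ LinearMap.ker g' := hker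
      refine ⟨ObjectProperty.homMk (ModuleCat.ofHom ((Submodule.liftQ _ g' hker).comp
        (LinearMap.quotKerEquivOfSurjective p hp).symm.toLinearMap)), ?_⟩
      refine ObjectProperty.hom_ext _ (ModuleCat.hom_ext (LinearMap.ext fun (r : Fin n → R) => ?_))
      change (Submodule.liftQ _ g' hker)
        ((LinearMap.quotKerEquivOfSurjective p hp).symm (p r)) = g' r
      have : (LinearMap.quotKerEquivOfSurjective p hp).symm (p r) = Submodule.Quotient.mk r := by
        rw [LinearEquiv.symm_apply_eq]
        rfl
      rw [this]
      rfl)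
  have hl (i : Fin n) (x : I.obj.obj (regular R)) :
      I.obj.map (spanMap (l i)) x = I.obj.map p' (I.obj.map (spanMap (free.basis i)) x) := by
    rw [← map_comp_apply', spanMap_comp]
  let γ : BalancedTensor R ((evR R).obj I) L.obj →+ I.obj.obj L :=
    ((tensorCounit R I).hom.app L).hom
  have hc (x : Fin n → (evR R).obj I) : γ (∑ i, BalancedTensor.tmul (x i) (l i)) =
      I.obj.map p' (∑ i, I.obj.map (spanMap (free.basis i))
        (toValue R x i)) := by
    rw [map_sum, map_sum]
    exact Finset.sum_congr rfl (fun i _ => hl i (x i))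
  constructor
  · refine (injective_iff_map_eq_zero γ).2 (fun t ht => ?_)
    obtain ⟨x, rfl⟩ := BalancedTensor.exists_eq_sum_tmul (X := (evR R).obj I) l (fun k => by
      obtain ⟨r, rfl⟩ := hp k
      exact ⟨r, hpl r⟩) t
    -- The tuple `(x i)`, seen in `I(Rⁿ)`, dies in `I(L)` and so comes from `w` in `I(Rᵐ)`. With `a`
    -- the matrix of `f` this says that `x i` is the sum over `j` of `w' j` times `a j i`; moving
    -- the scalars across leaves `∑ i, a j i • l i`, the value of `p ∘ f` at a basis vector, which
    -- is zero.
    obtain ⟨w, hw⟩ := (he _).1 ((hc x).symm.trans ht)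
    let a (j : Fin m) : Fin n → R := f (Pi.single j 1)
    let w' (j : Fin m) : (evR R).obj I := I.obj.map (free.proj j) w
    have hx (i : Fin n) : x i =
        ∑ j, MulOpposite.op (a j i) • w' j := by
      have e := free.map_proj_sum I (toValue R x) i
      refine e.symm.trans ?_
      rw [← hw, ← map_comp_apply', ← free.sum_map I w, map_sum]
      refine Finset.sum_congr rfl (fun j _ => ?_)
      refine (map_comp_apply' I.obj (spanMap (free.basis j)) (f' ≫ free.proj i) _).symm.trans ?_
      rw [spanMap_comp]
      rfl
    have h1 (i : Fin n) : BalancedTensor.tmul (R := R) (x i) (l i) =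
        ∑ j, BalancedTensor.tmul (w' j) (a j i • l i) := by
      rw [hx, BalancedTensor.sum_tmul]
      exact Finset.sum_congr rfl (fun j _ => BalancedTensor.smul_tmul (a j i) (w' j) (l i))
    rw [Finset.sum_congr rfl (fun i _ => h1 i), Finset.sum_comm]
    refine Finset.sum_eq_zero (fun j _ => ?_)
    rw [← BalancedTensor.tmul_sum]
    have h2 : ∑ i, a j i • l i = 0 := (hpl (a j)).trans (hfp' _)
    rw [h2]
    exact map_zero (BalancedTensor.tmulHom _)
  · intro y
    obtain ⟨z, rfl⟩ := hs y
    let x (i : Fin n) : (evR R).obj I := I.obj.map (free.proj i) z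
    refine ⟨∑ i, BalancedTensor.tmul (x i) (l i), (hc x).trans ?_⟩
    exact congrArg _ (free.sum_map I z)

end TensorAdjunction

/-! ### The adjunction between `D_L` and `D_A`, and the kernel of `D_A`. -/

section Localization

variable (R : Type u) [Ring R]

instance : (DA R).Additive :=
  inferInstanceAs ((w (ModuleCat.{u} Rᵐᵒᵖ) ⋙ (tensorEmbedding R).op).leftDerived 0).Additive

instance : PreservesFiniteColimits (DA R) :=
  inferInstanceAs (PreservesFiniteColimits
    ((w (ModuleCat.{u} Rᵐᵒᵖ) ⋙ (tensorEmbedding R).op).leftDerived 0))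

/-- On representable functors, `D_A` is the tensor embedding. -/
noncomputable def yonCompDA :
    yon (ModuleCat.{u} Rᵐᵒᵖ) ⋙ DA R ≅ (tensorEmbedding R).op :=
  let φ : yon (ModuleCat.{u} Rᵐᵒᵖ) ⋙ DA R ⟶ yon _ ⋙ w _ ⋙ (tensorEmbedding R).op :=
    Functor.whiskerLeft _ (w (ModuleCat.{u} Rᵐᵒᵖ) ⋙ (tensorEmbedding R).op).fromLeftDerivedZero
  have (X : (ModuleCat.{u} Rᵐᵒᵖ)ᵒᵖ) : IsIso (φ.app X) :=
    inferInstanceAs (IsIso ((w (ModuleCat.{u} Rᵐᵒᵖ) ⋙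
      (tensorEmbedding R).op).fromLeftDerivedZero.app ((yon (ModuleCat.{u} Rᵐᵒᵖ)).obj X)))
  have : IsIso φ := NatIso.isIso_of_isIso_app _
  asIso φ ≪≫ Functor.isoWhiskerRight
    (asIso (Adjunction.ofIsRightAdjoint (yon (ModuleCat.{u} Rᵐᵒᵖ))).counit) (tensorEmbedding R).op ≪≫
    (tensorEmbedding R).op.leftUnitor

/-- The transformation `1 ⟶ D_A ∘ Y ∘ ev_R` induced by `G(R) ⊗_R - ⟶ G`. -/
noncomputable def unitDA :
    𝟭 (AddFun R)ᵒᵖ ⟶ ((evR R).op ⋙ yon (ModuleCat.{u} Rᵐᵒᵖ)) ⋙ DA R where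
  app G := ((tensorAdjunction R).counit.app G.unop).op ≫
    (yonCompDA R).inv.app (op ((evR R).obj G.unop))
  naturality G G' α := by
    have h1 := congrArg Quiver.Hom.op ((tensorAdjunction R).counit.naturality α.unop)
    have h2 := (yonCompDA R).inv.naturality ((evR R).map α.unop).op
    refine Eq.trans ?_ ((congrArg (((tensorAdjunction R).counit.app G.unop).op ≫ ·) h2).trans
      (Category.assoc _ _ _).symm)
    exact congrArg (· ≫ (yonCompDA R).inv.app (op ((evR R).obj G'.unop))) h1.symm

/-- Up to the isomorphism `yonCompDA`, this is the hom-set bijection of the adjunction between `t`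
and `ev_R`, read in the opposite categories. -/
lemma bijective_unitDA (P : (AddFun R)ᵒᵖ) (B : (ModuleCat.{u} Rᵐᵒᵖ)ᵒᵖ) :
    Function.Bijective (fun g : op ((evR R).obj P.unop) ⟶ B =>
      (unitDA R).app P ≫ (DA R).map ((yon _).map g)) := by
  have h (g : op ((evR R).obj P.unop) ⟶ B) :
      (unitDA R).app P ≫ (DA R).map ((yon _).map g) =
        (((tensorAdjunction R).homEquiv _ _).symm g.unop).op ≫ (yonCompDA R).inv.app B := by
    rw [Adjunction.homEquiv_counit]
    have h2 := (yonCompDA R).inv.naturality g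
    exact (Category.assoc _ _ _).trans
      ((congrArg (((tensorAdjunction R).counit.app P.unop).op ≫ ·) h2.symm).trans
        (Category.assoc _ _ _).symm)
  constructor
  · intro g g' e
    have e' := (h g).symm.trans (Eq.trans e (h g'))
    rw [cancel_mono] at e'
    exact Quiver.Hom.unop_inj (((tensorAdjunction R).homEquiv _ _).symm.injective
      (Quiver.Hom.op_inj e'))
  · intro ψ
    let ψ' : P ⟶ op ((tensorEmbedding R).obj B.unop) := ψ ≫ (yonCompDA R).hom.app B
    refine ⟨((tensorAdjunction R).homEquiv _ _ ψ'.unop).op, (h _).trans ?_⟩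
    change (((tensorAdjunction R).homEquiv _ _).symm
      ((tensorAdjunction R).homEquiv _ _ ψ'.unop)).op ≫ _ = ψ
    rw [Equiv.symm_apply_apply]
    change (ψ ≫ (yonCompDA R).hom.app B) ≫ (yonCompDA R).inv.app B = ψ
    rw [Category.assoc, Iso.hom_inv_id_app]
    exact Category.comp_id ψ

theorem exists_adjunction : ∃ adj : DL R ⊣ DA R, IsIso adj.unit := by
  have inj (P : (AddFun R)ᵒᵖ) [Projective P] : Injective P.unop :=
    Injective.injective_iff_projective_op.2 (inferInstanceAs (Projective P))
  refine exists_adjunction_leftDerived (DA R) ((evR R).op ⋙ yon (ModuleCat.{u} Rᵐᵒᵖ))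
    (unitDA R) (fun P _ => ?_) (fun P _ Y => ?_)
  · have := inj P
    have : IsIso ((tensorAdjunction R).counit.app P.unop) := isIso_tensorCounit_of_injective R P.unop
    exact inferInstanceAs (IsIso (((tensorAdjunction R).counit.app P.unop).op ≫
      (yonCompDA R).inv.app (op ((evR R).obj P.unop))))
  · exact bijective_comp_map_of_projective (DA R) ((unitDA R).app P) (bijective_unitDA R P) Y

/-- Right exactness makes `D_A F` the cokernel, in the opposite category, of `D_A (f, -) ≅ (t f)ᵒᵖ`;
it vanishes when that map is epi. -/
lemma isZero_DA_iff_mono {F : FPFun R} {X Y : ModuleCat.{u} Rᵐᵒᵖ} {f : X ⟶ Y} {x : F.obj.obj X}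
    (h : EltPres F.obj f x) : IsZero ((DA R).obj F) ↔ Mono ((tensorEmbedding R).map f) := by
  refine (isZero_obj_iff_epi (DA R) h).trans ?_
  have e : Arrow.mk ((DA R).map ((yon _).map f.op)) ≅ Arrow.mk ((tensorEmbedding R).map f).op :=
    Arrow.isoMk ((yonCompDA R).app _) ((yonCompDA R).app _)
      ((yonCompDA R).hom.naturality f.op).symm
  refine ((MorphismProperty.epimorphisms _).arrow_iso_iff e).trans ?_
  exact ⟨fun (_ : Epi ((tensorEmbedding R).map f).op) =>
    unop_mono_of_epi ((tensorEmbedding R).map f).op, fun _ => op_epi_of_mono ((tensorEmbedding R).map f)⟩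

theorem isZero_DA_iff (F : FPFun R) : IsZero ((DA R).obj F) ↔ ArisesFromPureExact R F := by
  constructor
  · intro hF
    obtain ⟨X, Y, f, x, h⟩ := exists_eltPres F
    have hm := (isZero_DA_iff_mono R h).1 hF
    -- Evaluation at `R` is a right adjoint, so it keeps `t f` mono; `f` inherits this through the
    -- monic unit `X ⟶ X ⊗_R R`.
    have hf : Mono f := by
      have : (evR R).PreservesMonomorphisms :=
        (evR R).preservesMonomorphisms_of_adjunction (tensorAdjunction R)
      have h1 : Mono (tensorUnit R X ≫ (evR R).map ((tensorEmbedding R).map f)) := mono_comp _ _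
      have h2 : f ≫ tensorUnit R Y = tensorUnit R X ≫ (evR R).map ((tensorEmbedding R).map f) :=
        (tensorAdjunction R).unit.naturality f
      rw [← h2] at h1
      exact mono_of_mono f (tensorUnit R Y)
    let S := ShortComplex.mk f (cokernel.π f) (cokernel.condition f)
    have hS : S.ShortExact := { exact := ShortComplex.exact_cokernel f }
    -- As a left adjoint, `t` is right exact, so purity of the cokernel sequence only needed `t f`
    -- mono.
    have hSt : (S.map (tensorEmbedding R)).ShortExact := by
      have := (tensorAdjunction R).leftAdjoint_preservesColimits
      obtain ⟨h1, h2⟩ := ((tensorEmbedding R).preservesFiniteColimits_tfae.out 3 0 :).1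
        inferInstance S hS
      exact { exact := h1, mono_f := hm, epi_g := h2 }
    refine ⟨S, ⟨hS, hSt⟩, fun A g g' e => ?_, fun A g => ?_, ofElt F.obj x,
      isRightExactSeq_of_eltPres h⟩
    · exact (cancel_epi (cokernel.π f)).1 e
    · constructor
      · intro hg
        exact ⟨cokernel.desc f g hg, cokernel.π_desc f g hg⟩
      · rintro ⟨k, rfl⟩
        exact (cokernel.condition_assoc f (k : cokernel f ⟶ A)).trans zero_comp
  · rintro ⟨S, ⟨hS, hSt⟩, -, -, π, hπ⟩
    have h := eltPres_of_isRightExactSeq hπ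
    have e : (elt (preadditiveCoyoneda.map S.f.op) : S.X₁ ⟶ S.X₂) = S.f := Category.comp_id S.f
    rw [e] at h
    exact (isZero_DA_iff_mono R h).2 hSt.mono_f

end Localization

end AGJ

/-! ### Assembly: reflective-type localization and its universal property. -/

theorem mainTheorem3 (R : Type u) [Ring R] :
    -- the universal property
    (∀ (A : Type u₁) [Category.{v₁} A] [Abelian A] (E : AGJ.FPFun R ⥤ A)
        [PreservesFiniteLimits E] [PreservesFiniteColimits E],
        (∀ F : AGJ.FPFun R, IsZero ((AGJ.DA R).obj F) → IsZero (E.obj F)) →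
        PreservesFiniteLimits (AGJ.DL R ⋙ E) ∧ PreservesFiniteColimits (AGJ.DL R ⋙ E) ∧
          Nonempty (AGJ.DA R ⋙ AGJ.DL R ⋙ E ≅ E) ∧
          ∀ (Θ : (AGJ.AddFun R)ᵒᵖ ⥤ A) [PreservesFiniteLimits Θ] [PreservesFiniteColimits Θ],
            Nonempty (AGJ.DA R ⋙ Θ ≅ E) → Nonempty (Θ ≅ AGJ.DL R ⋙ E)) ∧
    -- `D_A` is exact, its kernel is a Serre subcategory, and `D_A` is the Serre localization at it
    (PreservesFiniteLimits (AGJ.DA R) ∧ PreservesFiniteColimits (AGJ.DA R) ∧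
      ∃ _ : (AGJ.DA R).kernel.IsSerreClass,
        (AGJ.DA R).IsLocalization (AGJ.DA R).kernel.isoModSerre ∧
        ∃ e : (AGJ.DA R).kernel.isoModSerre.Localization ≌ (AGJ.AddFun R)ᵒᵖ,
          Nonempty ((AGJ.DA R).kernel.isoModSerre.Q ⋙ e.functor ≅ AGJ.DA R)) ∧
    -- the kernel consists of the functors arising from pure exact sequences
    (∀ F : AGJ.FPFun R, IsZero ((AGJ.DA R).obj F) ↔ AGJ.ArisesFromPureExact R F) := by
  obtain ⟨adj, hu⟩ := AGJ.exists_adjunction R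
  have hlim : PreservesFiniteLimits (AGJ.DA R) :=
    have := adj.rightAdjoint_preservesLimits
    inferInstance
  have hcolim : PreservesFiniteColimits (AGJ.DA R) := inferInstance
  have hS : (AGJ.DA R).kernel.IsSerreClass := inferInstance
  have : (AGJ.DL R).Full := adj.fullyFaithfulLOfIsIsoUnit.full
  have : (AGJ.DL R).Faithful := adj.fullyFaithfulLOfIsIsoUnit.faithful
  have hloc : (AGJ.DA R).IsLocalization (AGJ.DA R).kernel.isoModSerre := by
    -- For an exact functor, having kernel and cokernel in the kernel class means being sent to an
    -- isomorphism; a functor with a fully faithful left adjoint is a localization at the morphisms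
    -- it inverts.
    rw [Abelian.isoModSerre_kernel_eq_inverseImage_isomorphisms]
    exact adj.isLocalization'
  refine ⟨?_, ⟨hlim, hcolim, hS, hloc, Localization.equivalenceFromModel _ _,
    ⟨Localization.qCompEquivalenceFromModelFunctorIso _ _⟩⟩, AGJ.isZero_DA_iff R⟩
  intro A _ _ E _ _ hE
  have hinv : (AGJ.DA R).kernel.isoModSerre.IsInvertedBy E :=
    ((AGJ.DA R).kernel.isoModSerre_isInvertedBy_iff E).2 hE
  -- By the triangle identity, `D_A` of the counit is inverse to an invertible unit, so the counit
  -- lies in the class that `E` inverts.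
  have (F : AGJ.FPFun R) : IsIso ((Functor.whiskerRight adj.counit E).app F) := by
    refine hinv (adj.counit.app F) ?_
    rw [Abelian.isoModSerre_kernel_eq_inverseImage_isomorphisms]
    exact IsIso.of_isIso_fac_left (adj.right_triangle_components F)
  have : IsIso (Functor.whiskerRight adj.counit E) := NatIso.isIso_of_isIso_app _
  let e : AGJ.DA R ⋙ AGJ.DL R ⋙ E ≅ E :=
    (Functor.associator _ _ _).symm ≪≫ asIso (Functor.whiskerRight adj.counit E) ≪≫ E.leftUnitor
  refine ⟨?_, ?_, ⟨e⟩, ?_⟩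
  · rw [← ObjectProperty.SerreClassLocalization.preservesFiniteLimits_comp_iff (AGJ.DA R)
      (AGJ.DA R).kernel]
    exact preservesFiniteLimits_of_natIso e.symm
  · rw [← ObjectProperty.SerreClassLocalization.preservesFiniteColimits_comp_iff (AGJ.DA R)
      (AGJ.DA R).kernel]
    exact preservesFiniteColimits_of_natIso e.symm
  · rintro Θ _ _ ⟨e'⟩
    -- The invertible unit gives `Θ ≅ Θ D_A D_L`, and `Θ D_A ≅ E` turns this into `E D_L`.
    exact ⟨Θ.leftUnitor.symm ≪≫ Functor.isoWhiskerRight (asIso adj.unit) Θ ≪≫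
      Functor.associator _ _ _ ≪≫ Functor.isoWhiskerLeft (AGJ.DL R) e'⟩
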